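/- Let $d\in\{1,2,3\}$, let $\Omega\subset\mathbb R^d$ be a bounded convex polygonal (polyhedral) domain, i.e. the nonempty interior of the convex hull of finitely many points, and let $0<\mu<1$ and $a_{\min}>0$. Write $\langle\cdot,\cdot\rangle$ and $\|\cdot\|$ for the inner product and norm of $L^2(\Omega)$, $\|v\|_1^2=\|v\|^2+\|\nabla v\|^2$ for the squared norm of $H^1(\Omega)$, and $\omega_{1-\mu}(t)=t^{-\mu}/\Gamma(1-\mu)$. There is a constant $C>0$, depending only on $\Omega$, $\mu$ and $a_{\min}$, such that the following holds. Let $T>0$, let $\mathcal A\in C^1([0,T],L^\infty(\Omega))$ be a real-valued (scalar) coefficient with $a_{\min}<\mathcal A(x,t)<a_{\max}<\infty$ for every $t\in[0,T]$ and almost every $x\in\Omega$, and put $a(t,v,w)=\int_\Omega \mathcal A(x,t)\nabla v(x)\cdot\nabla w(x)\,dx$. Let $S_h\subset H^1_0(\Omega)$ be the space of continuous functions that vanish on $\partial\Omega$ and are affine on each simplex of a given finite conforming simplicial partition of $\overline\Omega$. Let $0=t_0<t_1<\dots<t_N=T$ and $I_n=(t_{n-1},t_n)$. Let $U^0\in L^2(\Omega)$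 and $f\in L^2((0,T),L^2(\Omega))$. Let $\mathcal P_1(S_h)$ be the set of polynomials of degree at most one in $t$ with coefficients in $S_h$. Consider the discontinuous Galerkin finite element scheme: find $U$ with $U|_{I_n}\in\mathcal P_1(S_h)$ for $1\le n\le N$ such that, for $1\le n\le N$ and all $X\in\mathcal P_1(S_h)$, $$\int_{I_n}\bigl[\langle {}^{R}D^{\mu}U,X\rangle+a(t,U,X)\bigr]\,dt=\int_{I_n}\langle f+\omega_{1-\mu}(t)\,U^0,X\rangle\,dt,$$ where ${}^{R}D^{\mu}U(t)=\frac{\partial}{\partial t}\int_0^t\omega_{1-\mu}(t-s)\,U(s)\,ds$. Then every solution $U$ of the scheme satisfies $$\int_0^T\|U\|_1^2\,dt\le C\,T^{1-\mu}\|U^0\|^2+C\int_0^T\|f\|^2\,dt .$$ Moreover, the scheme has a solution $U$, and it is unique: any two solutions coincide on $I_1\cup\dots\cup I_N$. -/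

import Mathlib

open Set MeasureTheory
open scoped ENNReal

namespace FracDG

/-- A bounded convex polygonal (polyhedral) domain of `ℝ^d`: the nonempty interior of the convex
hull of finitely many points. -/
def IsConvexPolytopalDomain {d : ℕ} (Ω : Set (EuclideanSpace ℝ (Fin d))) : Prop :=
  Ω.Nonempty ∧ ∃ V : Finset (EuclideanSpace ℝ (Fin d)),
    Ω = interior (convexHull ℝ (V : Set (EuclideanSpace ℝ (Fin d))))

/-- A conforming partition of `Ω` into finitely many simplices: a finite simplicial complex (two
simplices meet in a common face or not at all) whose union is the closure of `Ω`. -/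
structure IsTriangulation {d : ℕ} (Ω : Set (EuclideanSpace ℝ (Fin d)))
    (K : Geometry.SimplicialComplex ℝ (EuclideanSpace ℝ (Fin d))) : Prop where
  finite : K.faces.Finite
  space_eq : K.space = closure Ω

/-- The finite element space `S_h`: continuous functions that are affine on every simplex of the
mesh and vanish on the boundary of `Ω`. They are extended by zero outside `Ω`, so that two elements
of the space are equal if and only if they agree on `Ω`. -/
def feSpace {d : ℕ} (Ω : Set (EuclideanSpace ℝ (Fin d)))
    (K : Geometry.SimplicialComplex ℝ (EuclideanSpace ℝ (Fin d))) :
    Submodule ℝ (EuclideanSpace ℝ (Fin d) → ℝ) where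
  carrier := {v | Continuous v ∧ (∀ x, x ∉ Ω → v x = 0) ∧
    ∀ s ∈ K.faces, ∃ p : EuclideanSpace ℝ (Fin d) →ᵃ[ℝ] ℝ,
      ∀ x ∈ convexHull ℝ (s : Set (EuclideanSpace ℝ (Fin d))), v x = p x}
  zero_mem' := ⟨continuous_const, fun _ _ => rfl, fun _ _ => ⟨0, fun _ _ => rfl⟩⟩
  add_mem' := by
    rintro v w ⟨hv, hv0, hvp⟩ ⟨hw, hw0, hwp⟩
    refine ⟨hv.add hw, fun x hx => by simp [hv0 x hx, hw0 x hx], fun s hs => ?_⟩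
    obtain ⟨p, hp⟩ := hvp s hs
    obtain ⟨q, hq⟩ := hwp s hs
    exact ⟨p + q, fun x hx => by simp [hp x hx, hq x hx]⟩
  smul_mem' := by
    rintro c v ⟨hv, hv0, hvp⟩
    refine ⟨hv.const_smul c, fun x hx => by simp [hv0 x hx], fun s hs => ?_⟩
    obtain ⟨p, hp⟩ := hvp s hs
    exact ⟨c • p, fun x hx => by simp [hp x hx]⟩

/-- The `L²(Ω)` inner product of two functions. -/
noncomputable def l2Inner {d : ℕ} (Ω : Set (EuclideanSpace ℝ (Fin d)))
    (v w : EuclideanSpace ℝ (Fin d) → ℝ) : ℝ :=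
  ∫ x in Ω, v x * w x

/-- The square `‖v‖₁²` of the norm of the Sobolev space `H¹(Ω)`. It is only applied to finite element
functions; these are Lipschitz, so the almost everywhere defined classical gradient is the weak
gradient. -/
noncomputable def h1NormSq {d : ℕ} (Ω : Set (EuclideanSpace ℝ (Fin d)))
    (v : EuclideanSpace ℝ (Fin d) → ℝ) : ℝ :=
  (∫ x in Ω, v x ^ 2) + ∫ x in Ω, ‖gradient v x‖ ^ 2

/-- The assumptions on the diffusivity: `A ∈ C¹([0,T], L^∞(Ω))` and `amin < A(x,t) < amax`. -/
structure IsDiffusivity {d : ℕ} (Ω : Set (EuclideanSpace ℝ (Fin d))) (T amin amax : ℝ)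
    (A : ℝ → Lp ℝ ∞ (volume.restrict Ω)) : Prop where
  contDiff : ContDiffOn ℝ 1 A (Icc 0 T)
  lower : ∀ t ∈ Icc 0 T, ∀ᵐ x ∂(volume.restrict Ω), amin < A t x
  upper : ∀ t ∈ Icc 0 T, ∀ᵐ x ∂(volume.restrict Ω), A t x < amax

/-- The bilinear form `a(t,v,w) = ∫_Ω A(x,t) ∇v(x) · ∇w(x) dx`. -/
noncomputable def bilin {d : ℕ} (Ω : Set (EuclideanSpace ℝ (Fin d)))
    (A : ℝ → Lp ℝ ∞ (volume.restrict Ω)) (t : ℝ) (v w : EuclideanSpace ℝ (Fin d) → ℝ) : ℝ :=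
  ∫ x in Ω, A t x * inner ℝ (gradient v x) (gradient w x)

/-- The kernel `ω_α(t) = t^(α-1) / Γ(α)`. -/
noncomputable def omega (α t : ℝ) : ℝ := t ^ (α - 1) / Real.Gamma α

/-- The Riemann–Liouville fractional derivative in time,
`(∂/∂t) ∫_0^t ω_{1-μ}(t-s) U(x,s) ds`, at time `t` and as a function of `x`. -/
noncomputable def rlDeriv {d : ℕ} (μ : ℝ) (U : ℝ → EuclideanSpace ℝ (Fin d) → ℝ) (t : ℝ) :
    EuclideanSpace ℝ (Fin d) → ℝ :=
  fun x => deriv (fun τ => ∫ s in (0 : ℝ)..τ, omega (1 - μ) (τ - s) * U s x) t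

/-- A time mesh `0 = t_0 < t_1 < ⋯ < t_N = T`. -/
structure IsTimeMesh (T : ℝ) {N : ℕ} (t : Fin (N + 1) → ℝ) : Prop where
  strictMono : StrictMono t
  first : t 0 = 0
  last : t (Fin.last N) = T

/-- The `n`-th open time interval between consecutive mesh points. -/
def timeInterval {N : ℕ} (t : Fin (N + 1) → ℝ) (n : Fin N) : Set ℝ :=
  Ioo (t n.castSucc) (t n.succ)

/-- The space of discontinuous Galerkin functions: on every time interval, `U` is a polynomial of
degree at most one in time with coefficients in the finite element space. -/
def IsDGFunction {d N : ℕ} (Ω : Set (EuclideanSpace ℝ (Fin d)))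
    (K : Geometry.SimplicialComplex ℝ (EuclideanSpace ℝ (Fin d))) (t : Fin (N + 1) → ℝ)
    (U : ℝ → feSpace Ω K) : Prop :=
  ∀ n : Fin N, ∃ p q : feSpace Ω K, ∀ s ∈ timeInterval t n, U s = p + s • q

/-- `U` solves the discontinuous Galerkin finite element scheme with initial datum `U0` and source
`f`: it is a discontinuous Galerkin function, and for every time interval `I_n` and all
`X(s) = p + s q` with `p, q` in the finite element space,
`∫_{I_n} (⟨D^μ U, X⟩ + a(s, U, X)) ds = ∫_{I_n} ⟨f + ω_{1-μ}(s) U0, X⟩ ds`. -/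
structure IsDGSolution {d N : ℕ} (μ : ℝ) (Ω : Set (EuclideanSpace ℝ (Fin d)))
    (A : ℝ → Lp ℝ ∞ (volume.restrict Ω))
    (K : Geometry.SimplicialComplex ℝ (EuclideanSpace ℝ (Fin d))) (t : Fin (N + 1) → ℝ)
    (U0 : Lp ℝ 2 (volume.restrict Ω)) (f : ℝ → Lp ℝ 2 (volume.restrict Ω))
    (U : ℝ → feSpace Ω K) : Prop where
  isDGFunction : IsDGFunction Ω K t U
  scheme : ∀ (n : Fin N) (p q : feSpace Ω K),
    (∫ s in timeInterval t n,
      (l2Inner Ω (rlDeriv μ (fun r => (U r : EuclideanSpace ℝ (Fin d) → ℝ)) s) (p + s • q).1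
        + bilin Ω A s (U s).1 (p + s • q).1))
      = ∫ s in timeInterval t n,
          l2Inner Ω (fun x => f s x + omega (1 - μ) s * U0 x) (p + s • q).1

end FracDG

/-! The estimate is an energy argument: the scheme is tested with the solution itself and summed
over the intervals. What makes it work is coercivity of the fractional derivative. For a scalar u
that is Lipschitz to the left of t, the function s ↦ (u(s) - u(t))² is nonnegative and vanishes to
second order at t; as the kernel decreases on positive times, its Riemann–Liouville derivative at t
is at most zero (`deriv_fracInt_nonpos`). Expanding the square, with D^μ 1 = ω_{1-μ}, gives u D^μ u
≥ D^μ(u²)/2 + ω_{1-μ} u²/2 (`mul_deriv_fracInt_ge`). The integral of D^μ(u²) over (0,T) is a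
fractional integral of u² at T, hence nonnegative, and ∫ u D^μ u ≥ ½ ∫ ω_{1-μ} u² remains. For
functions with values in S_h this is applied at each point x and integrated over Ω
(`integral_l2Form_coercive`).

The surviving weight absorbs the U⁰ load exactly: ω⟨U⁰,U⟩ ≤ ω‖U⁰‖²/2 + ω‖U‖²/2, and the integral of
ω over (0,T) produces T^{1-μ}. The source f is absorbed by half of the diffusion through
`exists_poincare`, whose constant sees only the domain. No Gronwall step occurs, so the constant is
independent of T, of both meshes and of the upper bound on the coefficient (`integral_h1NormSq_le`).

For existence and uniqueness, the scheme is a square linear system for the coefficients in a basis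
in time (`isDGSolution_iff`). The estimate with zero data makes the system injective, hence
surjective by finite dimension.

Regularity in time is elementary: piecewise polynomials are combinations of truncated powers, whose
fractional integrals are again truncated powers. -/

namespace FracDG

open Filter Topology

/-! ### Calculus of scalar fractional integrals. -/

/-- The fractional integral `∫_0^τ ω_{1-μ}(τ-s) g(s) ds` of a scalar function. -/
noncomputable def fracInt (μ : ℝ) (g : ℝ → ℝ) (τ : ℝ) : ℝ :=
  ∫ s in (0 : ℝ)..τ, omega (1 - μ) (τ - s) * g s

/-- `g` has a continuous fractional integral on `[0,T]` that is differentiable off `S` and whose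
derivative is integrable. -/
structure HasFracDeriv (μ T : ℝ) (S : Set ℝ) (g : ℝ → ℝ) : Prop where
  integrable : ∀ τ ∈ Icc 0 T,
    IntervalIntegrable (fun s => omega (1 - μ) (τ - s) * g s) volume 0 τ
  continuousOn : ContinuousOn (fracInt μ g) (Icc 0 T)
  differentiableAt : ∀ t ∈ Ioo 0 T \ S, DifferentiableAt ℝ (fracInt μ g) t
  integrableOn_deriv : IntegrableOn (deriv (fracInt μ g)) (Ioo 0 T)

variable {μ T : ℝ} {S : Set ℝ} {g h : ℝ → ℝ}

lemma omega_nonneg (hμ1 : μ < 1) {t : ℝ} (ht : 0 ≤ t) : 0 ≤ omega (1 - μ) t :=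
  div_nonneg (Real.rpow_nonneg ht _) (Real.Gamma_pos_of_pos (by linarith)).le

lemma intervalIntegrable_omega (hμ1 : μ < 1) (a b : ℝ) :
    IntervalIntegrable (omega (1 - μ)) volume a b :=
  (intervalIntegral.intervalIntegrable_rpow' (by linarith : -1 < 1 - μ - 1)).div_const _

lemma intervalIntegrable_omega_sub (hμ1 : μ < 1) (τ a b : ℝ) :
    IntervalIntegrable (fun s => omega (1 - μ) (τ - s)) volume a b := by
  have := (intervalIntegrable_omega hμ1 (τ - a) (τ - b)).comp_sub_left τ
  simpa using this

lemma integrableOn_omega (hμ1 : μ < 1) (hT : 0 ≤ T) :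
    IntegrableOn (omega (1 - μ)) (Ioo 0 T) :=
  ((intervalIntegrable_iff_integrableOn_Ioo_of_le hT).1 (intervalIntegrable_omega hμ1 0 T))

lemma integral_omega (hμ1 : μ < 1) (t : ℝ) :
    ∫ s in (0 : ℝ)..t, omega (1 - μ) s = t ^ (1 - μ) / ((1 - μ) * Real.Gamma (1 - μ)) := by
  unfold omega
  rw [intervalIntegral.integral_div, integral_rpow (Or.inl (by linarith))]
  have : (1 - μ) ≠ 0 := by linarith
  rw [show 1 - μ - 1 + 1 = 1 - μ by ring, Real.zero_rpow this]
  field_simp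
  simp

lemma ae_restrict_Ioo_diff (hS : S.Countable) : ∀ᵐ t ∂(volume.restrict (Ioo 0 T)), t ∈ Ioo 0 T \ S := by
  filter_upwards [ae_restrict_mem measurableSet_Ioo, ae_restrict_of_ae (hS.ae_notMem volume)]
    with t h1 h2 using ⟨h1, h2⟩

namespace HasFracDeriv

lemma fracInt_add (hg : HasFracDeriv μ T S g) (hh : HasFracDeriv μ T S h) {τ : ℝ}
    (hτ : τ ∈ Icc 0 T) :
    fracInt μ (fun s => g s + h s) τ = fracInt μ g τ + fracInt μ h τ := by
  unfold fracInt
  rw [← intervalIntegral.integral_add (hg.integrable τ hτ) (hh.integrable τ hτ)]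
  simp only [mul_add]

lemma fracInt_add_eventuallyEq (hg : HasFracDeriv μ T S g) (hh : HasFracDeriv μ T S h) {t : ℝ}
    (ht : t ∈ Ioo 0 T) :
    fracInt μ (fun s => g s + h s) =ᶠ[𝓝 t] fun τ => fracInt μ g τ + fracInt μ h τ := by
  filter_upwards [Ioo_mem_nhds ht.1 ht.2] with τ hτ
  exact fracInt_add hg hh (Ioo_subset_Icc_self hτ)

lemma deriv_add (hg : HasFracDeriv μ T S g) (hh : HasFracDeriv μ T S h) {t : ℝ}
    (ht : t ∈ Ioo 0 T \ S) :
    deriv (fracInt μ (fun s => g s + h s)) t = deriv (fracInt μ g) t + deriv (fracInt μ h) t := by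
  rw [(fracInt_add_eventuallyEq hg hh ht.1).deriv_eq]
  exact _root_.deriv_fun_add (hg.differentiableAt t ht) (hh.differentiableAt t ht)

lemma add (hS : S.Countable) (hg : HasFracDeriv μ T S g) (hh : HasFracDeriv μ T S h) :
    HasFracDeriv μ T S (fun s => g s + h s) where
  integrable τ hτ := by
    simpa only [mul_add] using (hg.integrable τ hτ).add (hh.integrable τ hτ)
  continuousOn := (hg.continuousOn.add hh.continuousOn).congr fun τ hτ => fracInt_add hg hh hτ
  differentiableAt t ht := by
    rw [(fracInt_add_eventuallyEq hg hh ht.1).differentiableAt_iff]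
    exact (hg.differentiableAt t ht).fun_add (hh.differentiableAt t ht)
  integrableOn_deriv := by
    refine (hg.integrableOn_deriv.add hh.integrableOn_deriv).congr ?_
    filter_upwards [ae_restrict_Ioo_diff hS] with t ht
    exact (deriv_add hg hh ht).symm

end HasFracDeriv

lemma fracInt_const_mul (c : ℝ) (g : ℝ → ℝ) :
    fracInt μ (fun s => c * g s) = fun τ => c * fracInt μ g τ := by
  ext τ
  unfold fracInt
  rw [← intervalIntegral.integral_const_mul]
  congr 1; ext s; ring

lemma deriv_fracInt_const_mul (c : ℝ) (g : ℝ → ℝ) (t : ℝ) :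
    deriv (fracInt μ (fun s => c * g s)) t = c * deriv (fracInt μ g) t := by
  rw [fracInt_const_mul, deriv_const_mul_field]

lemma fracInt_congr_ae (h0 : ∀ᵐ s, s ∈ Ioo 0 T → g s = h s) {τ : ℝ} (hτ : τ ∈ Icc 0 T) :
    fracInt μ g τ = fracInt μ h τ := by
  refine intervalIntegral.integral_congr_ae ?_
  -- The hypothesis is silent at `T`, which the range of integration contains when `τ = T`.
  have : ∀ᵐ s : ℝ, s ≠ T := by simp [ae_iff]
  filter_upwards [h0, this] with s hs hsT hs2
  rw [uIoc_of_le hτ.1] at hs2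
  rw [hs ⟨hs2.1, lt_of_le_of_ne (hs2.2.trans hτ.2) hsT⟩]

lemma deriv_fracInt_congr_ae (h0 : ∀ᵐ s, s ∈ Ioo 0 T → g s = h s) {t : ℝ} (ht : t ∈ Ioo 0 T) :
    deriv (fracInt μ g) t = deriv (fracInt μ h) t := by
  refine Filter.EventuallyEq.deriv_eq ?_
  filter_upwards [Ioo_mem_nhds ht.1 ht.2] with τ hτ
  exact fracInt_congr_ae h0 (Ioo_subset_Icc_self hτ)

namespace HasFracDeriv

lemma const_mul (hg : HasFracDeriv μ T S g) (c : ℝ) :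
    HasFracDeriv μ T S (fun s => c * g s) where
  integrable τ hτ := by
    refine ((hg.integrable τ hτ).const_mul c).congr ?_
    intro s _; simp only []; ring
  continuousOn := by
    rw [fracInt_const_mul]; exact hg.continuousOn.const_mul c
  differentiableAt t ht := by
    rw [fracInt_const_mul]; exact (hg.differentiableAt t ht).const_mul c
  integrableOn_deriv := by
    refine (hg.integrableOn_deriv.const_mul c).congr ?_
    filter_upwards with t using (deriv_fracInt_const_mul c g t).symm

lemma congr_ae (hg : HasFracDeriv μ T S g) (h0 : ∀ᵐ s, s ∈ Ioo 0 T → g s = h s) :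
    HasFracDeriv μ T S h where
  integrable τ hτ := by
    refine (hg.integrable τ hτ).congr_ae ?_
    have : ∀ᵐ s : ℝ, s ≠ T := by simp [ae_iff]
    filter_upwards [ae_restrict_of_ae h0, ae_restrict_of_ae this, ae_restrict_mem measurableSet_uIoc]
      with s hs hsT hs2
    rw [uIoc_of_le hτ.1] at hs2
    rw [hs ⟨hs2.1, lt_of_le_of_ne (hs2.2.trans hτ.2) hsT⟩]
  continuousOn := hg.continuousOn.congr fun τ hτ => (fracInt_congr_ae h0 hτ).symm
  differentiableAt t ht := by
    refine (hg.differentiableAt t ht).congr_of_eventuallyEq ?_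
    filter_upwards [Ioo_mem_nhds ht.1.1 ht.1.2] with τ hτ
    exact (fracInt_congr_ae h0 (Ioo_subset_Icc_self hτ)).symm
  integrableOn_deriv := by
    refine hg.integrableOn_deriv.congr ?_
    filter_upwards [ae_restrict_mem measurableSet_Ioo] with t ht
    exact deriv_fracInt_congr_ae h0 ht

lemma zero : HasFracDeriv μ T S (fun _ => 0) where
  integrable τ hτ := by simp
  continuousOn := by
    have : fracInt μ (fun _ => 0) = fun _ => 0 := by ext; simp [fracInt]
    rw [this]; exact continuousOn_const
  differentiableAt t ht := by
    have : fracInt μ (fun _ => 0) = fun _ => 0 := by ext; simp [fracInt]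
    rw [this]; exact differentiableAt_const _
  integrableOn_deriv := by
    have : fracInt μ (fun _ => 0) = fun _ => 0 := by ext; simp [fracInt]
    rw [this]; simp

lemma sum (hS : S.Countable) {ι : Type*} (s : Finset ι) {g : ι → ℝ → ℝ}
    (hg : ∀ i ∈ s, HasFracDeriv μ T S (g i)) :
    HasFracDeriv μ T S (fun x => ∑ i ∈ s, g i x) := by
  classical
  induction s using Finset.induction_on with
  | empty => simpa using zero
  | insert a s ha ih =>
    simp only [Finset.sum_insert ha]
    exact add hS (hg _ (Finset.mem_insert_self _ _))
      (ih fun i hi => hg i (Finset.mem_insert_of_mem hi))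

lemma deriv_sum (hS : S.Countable) {ι : Type*} (s : Finset ι) {g : ι → ℝ → ℝ}
    (hg : ∀ i ∈ s, HasFracDeriv μ T S (g i)) {t : ℝ} (ht : t ∈ Ioo 0 T \ S) :
    deriv (fracInt μ (fun x => ∑ i ∈ s, g i x)) t = ∑ i ∈ s, deriv (fracInt μ (g i)) t := by
  classical
  induction s using Finset.induction_on with
  | empty =>
    have : fracInt μ (fun _ => 0) = fun _ => 0 := by ext; simp [fracInt]
    simp [this]
  | insert a s ha ih =>
    simp only [Finset.sum_insert ha]
    have h2 : ∀ i ∈ s, HasFracDeriv μ T S (g i) := fun i hi => hg i (Finset.mem_insert_of_mem hi)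
    rw [deriv_add (hg _ (Finset.mem_insert_self _ _)) (sum hS s h2) ht, ih h2]

/-- The fundamental theorem of calculus with a countable exceptional set; the boundary term at 0
vanishes because the integral over an empty interval does. -/
lemma integral_deriv (hS : S.Countable) (hT : 0 ≤ T) (hg : HasFracDeriv μ T S g) :
    ∫ t in Ioo 0 T, deriv (fracInt μ g) t = fracInt μ g T := by
  have := integral_eq_of_hasDerivAt_off_countable_of_le (fracInt μ g) (deriv (fracInt μ g)) hT hS
    hg.continuousOn (fun x hx => (hg.differentiableAt x hx).hasDerivAt)
    ((intervalIntegrable_iff_integrableOn_Ioo_of_le hT).2 hg.integrableOn_deriv)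
  rw [intervalIntegral.integral_of_le hT, integral_Ioc_eq_integral_Ioo] at this
  rw [this]
  simp [fracInt]

end HasFracDeriv

/-! ### Fractional integrals of piecewise polynomials. -/

/-- The truncated power `(s-a)_+^m`. -/
noncomputable def truncPow (a : ℝ) (m : ℕ) (s : ℝ) : ℝ := if a < s then (s - a) ^ m else 0

lemma measurable_truncPow (a : ℝ) (m : ℕ) : Measurable (truncPow a m) :=
  Measurable.ite measurableSet_Ioi (by fun_prop) measurable_const

lemma intervalIntegrable_omega_mul_truncPow (hμ1 : μ < 1) (a : ℝ) (m : ℕ) (τ b c : ℝ) :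
    IntervalIntegrable (fun s => omega (1 - μ) (τ - s) * truncPow a m s) volume b c := by
  have h1 := intervalIntegrable_omega_sub hμ1 τ b c
  rw [intervalIntegrable_iff] at h1 ⊢
  refine h1.mul_bdd (c := (|b| + |c| + |a|) ^ m) (measurable_truncPow a m).aestronglyMeasurable ?_
  filter_upwards [ae_restrict_mem measurableSet_uIoc] with s hs
  unfold truncPow
  split_ifs with h
  · rw [norm_pow]
    refine pow_le_pow_left₀ (norm_nonneg _) ?_ _
    rw [Real.norm_eq_abs]
    have h3 : |s| ≤ |b| + |c| := by
      rcases mem_uIoc.1 hs with h | h <;>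
      · apply abs_le.2
        constructor <;>
        linarith [neg_abs_le b, neg_abs_le c, le_abs_self b, le_abs_self c, abs_nonneg b, abs_nonneg c]
    linarith [abs_sub s a]
  · simp; positivity

/-- By homogeneity: the substitution s = a + (τ - a) r extracts the power of τ - a and leaves a Beta
integral, whose value is never needed. -/
lemma exists_fracInt_truncPow (hμ1 : μ < 1) {a : ℝ} (ha : 0 ≤ a) (m : ℕ) :
    ∃ B : ℝ, ∀ τ, 0 ≤ τ → fracInt μ (truncPow a m) τ = B * (max (τ - a) 0) ^ (m + (1 - μ)) := by
  refine ⟨∫ r in (0 : ℝ)..1, omega (1 - μ) (1 - r) * r ^ m, fun τ hτ => ?_⟩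
  have hβ : (m : ℝ) + (1 - μ) ≠ 0 := by
    have : (0 : ℝ) ≤ m := Nat.cast_nonneg m
    linarith
  unfold fracInt
  rcases le_or_gt τ a with h | h
  · rw [max_eq_right (by linarith), Real.zero_rpow hβ, mul_zero]
    refine Eq.trans ?_ (intervalIntegral.integral_zero (a := (0 : ℝ)) (b := τ) (μ := volume))
    refine intervalIntegral.integral_congr fun s hs => ?_
    rw [uIcc_of_le hτ] at hs
    have : ¬ a < s := by linarith [hs.2]
    simp [truncPow, this]
  · rw [max_eq_left (by linarith)]
    have e0 : ∫ s in (0 : ℝ)..a, omega (1 - μ) (τ - s) * truncPow a m s = 0 := by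
      refine Eq.trans ?_ (intervalIntegral.integral_zero (a := (0 : ℝ)) (b := a) (μ := volume))
      refine intervalIntegral.integral_congr fun s hs => ?_
      rw [uIcc_of_le ha] at hs
      have : ¬ a < s := by linarith [hs.2]
      simp [truncPow, this]
    rw [← intervalIntegral.integral_add_adjacent_intervals
      (intervalIntegrable_omega_mul_truncPow hμ1 a m τ 0 a)
      (intervalIntegrable_omega_mul_truncPow hμ1 a m τ a τ), e0, zero_add]
    have e1 := intervalIntegral.mul_integral_comp_add_mul (a := 0) (b := 1)
      (f := fun s => omega (1 - μ) (τ - s) * truncPow a m s) (c := τ - a) (d := a)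
    simp only [mul_zero, add_zero, mul_one, add_sub_cancel] at e1
    rw [← e1, mul_comm _ ((τ - a) ^ _), ← intervalIntegral.integral_const_mul,
      ← intervalIntegral.integral_const_mul]
    refine intervalIntegral.integral_congr_ae ?_
    filter_upwards with r hr
    rw [uIoc_of_le zero_le_one] at hr
    have hp : 0 < τ - a := by linarith
    have h2 : a < a + (τ - a) * r := by nlinarith [mul_pos hp hr.1]
    have h3 : τ - (a + (τ - a) * r) = (τ - a) * (1 - r) := by ring
    simp only [truncPow, h2, if_true, h3, omega, add_sub_cancel_left]
    rw [Real.mul_rpow hp.le (by linarith [hr.2]), mul_pow, Real.rpow_add hp, Real.rpow_natCast,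
      show (1 - μ) = (1 - μ - 1) + 1 by ring, Real.rpow_add hp, Real.rpow_one]
    ring_nf

lemma hasFracDeriv_truncPow (hμ1 : μ < 1) (hT : 0 ≤ T) {a : ℝ} (ha : 0 ≤ a)
    (haS : a ∈ S) (m : ℕ) : HasFracDeriv μ T S (truncPow a m) := by
  obtain ⟨B, hB⟩ := exists_fracInt_truncPow hμ1 ha m
  have hm : (0 : ℝ) ≤ m := Nat.cast_nonneg m
  have hβ : (0 : ℝ) < (m : ℝ) + (1 - μ) := by linarith
  have hD : ∀ t, 0 < t → t ≠ a → HasDerivAt (fracInt μ (truncPow a m))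
      (if a < t then B * ((m + (1 - μ)) * (t - a) ^ (m + (1 - μ) - 1)) else 0) t := by
    intro t ht hta
    have hev : ∀ᶠ τ in 𝓝 t, fracInt μ (truncPow a m) τ = B * (max (τ - a) 0) ^ (m + (1 - μ)) := by
      filter_upwards [Ioi_mem_nhds ht] with τ hτ using hB τ (le_of_lt hτ)
    refine HasDerivAt.congr_of_eventuallyEq ?_ hev
    rcases lt_or_gt_of_ne hta with h | h
    · rw [if_neg (by linarith)]
      refine (hasDerivAt_const t (0 : ℝ)).congr_of_eventuallyEq ?_
      filter_upwards [Iio_mem_nhds h] with τ hτ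
      have : τ < a := hτ
      rw [max_eq_right (by linarith), Real.zero_rpow hβ.ne', mul_zero]
    · rw [if_pos h]
      have h1 : HasDerivAt (fun τ => B * (τ - a) ^ (m + (1 - μ)))
          (B * ((m + (1 - μ)) * (t - a) ^ (m + (1 - μ) - 1))) t := by
        have := (((hasDerivAt_id t).sub_const a).rpow_const (p := m + (1 - μ))
          (Or.inl (by simp; linarith))).const_mul B
        refine this.congr_deriv ?_
        simp
      refine h1.congr_of_eventuallyEq ?_
      filter_upwards [Ioi_mem_nhds h] with τ hτ
      have : a < τ := hτ
      rw [max_eq_left (by linarith)]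
  refine ⟨fun τ _ => intervalIntegrable_omega_mul_truncPow hμ1 a m τ 0 τ, ?_, ?_, ?_⟩
  · refine ContinuousOn.congr (f := fun τ => B * (max (τ - a) 0) ^ (m + (1 - μ))) ?_
      fun τ hτ => hB τ hτ.1
    refine Continuous.continuousOn (continuous_const.mul ?_)
    exact ((continuous_id.sub continuous_const).max continuous_const).rpow_const
      fun _ => Or.inr hβ.le
  · intro t ht
    exact (hD t ht.1.1 fun h => ht.2 (h ▸ haS)).differentiableAt
  -- The exponent is m - μ > -1, so even for m = 0 the singularity of the derivative at `a` is
  -- integrable.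
  · have h1 : IntervalIntegrable (fun t => (t - a) ^ (m + (1 - μ) - 1)) volume 0 T := by
      have := (intervalIntegral.intervalIntegrable_rpow' (a := 0 - a) (b := T - a)
        (by linarith : -1 < m + (1 - μ) - 1)).comp_sub_right a
      simpa using this
    rw [intervalIntegrable_iff_integrableOn_Ioo_of_le hT] at h1
    have h2 : IntegrableOn ((Ioi a).indicator
        fun t => B * ((m + (1 - μ)) * (t - a) ^ (m + (1 - μ) - 1))) (Ioo 0 T) :=
      ((h1.const_mul _).const_mul _).indicator measurableSet_Ioi
    refine h2.congr ?_
    filter_upwards [ae_restrict_Ioo_diff (countable_singleton a)] with t ht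
    rw [(hD t ht.1.1 fun h => ht.2 h).deriv]
    simp [indicator]

lemma hasFracDeriv_indicator_pow (hS : S.Countable) (hμ1 : μ < 1) (hT : 0 ≤ T)
    {a b : ℝ} (ha : 0 ≤ a) (hab : a ≤ b) (haS : a ∈ S) (hbS : b ∈ S) (m : ℕ) :
    HasFracDeriv μ T S ((Ioo a b).indicator fun s => s ^ m) := by
  -- For s > c, the binomial expansion of ((s - c) + c)^m is a combination of truncated powers at c.
  have key : ∀ c, 0 ≤ c → c ∈ S → HasFracDeriv μ T S ((Ioi c).indicator fun s => s ^ m) := by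
    intro c hc hcS
    have : (Ioi c).indicator (fun s => s ^ m) =
        fun s => ∑ i ∈ Finset.range (m + 1), (c ^ (m - i) * m.choose i) * truncPow c i s := by
      ext s
      by_cases h : c < s
      · simp only [indicator, mem_Ioi, h, if_true, truncPow]
        conv_lhs => rw [← sub_add_cancel s c, add_pow]
        exact Finset.sum_congr rfl fun i _ => by ring
      · simp [indicator, h, truncPow]
    rw [this]
    exact HasFracDeriv.sum hS _ fun i _ =>
      (hasFracDeriv_truncPow hμ1 hT hc hcS i).const_mul _
  -- The indicator of (a,b) is that of s > a minus that of s > b, except at s = b.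
  refine ((key a ha haS).add hS ((key b (ha.trans hab) hbS).const_mul (-1))).congr_ae ?_
  have : ∀ᵐ s : ℝ, s ≠ b := by simp [ae_iff]
  filter_upwards [this] with s hs _
  rcases lt_or_gt_of_ne hs with h | h
  · have : ¬ b < s := by linarith
    simp [indicator, h, this]
  · have h1 : ¬ s < b := by linarith
    have h2 : a < s := by linarith
    simp [indicator, h, h1, h2]

/-! ### Pointwise coercivity of the fractional derivative. -/

/-- At a minimum of a nonnegative function vanishing there, the fractional derivative is
nonpositive. -/
lemma deriv_fracInt_nonpos (hμ0 : 0 < μ) (hμ1 : μ < 1) {t M δ : ℝ} (ht : t ∈ Ioo 0 T) (hδ : 0 < δ)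
    (hM : 0 ≤ M)
    (hint : ∀ τ ∈ Icc 0 T,
      IntervalIntegrable (fun s => omega (1 - μ) (τ - s) * g s) volume 0 τ)
    (hg : ∀ s, 0 ≤ g s) (hgt : ∀ s ∈ Ioo (t - δ) t, g s ≤ M * (t - s)) :
    deriv (fracInt μ g) t ≤ 0 := by
  -- Without differentiability `deriv` takes the default value 0 and the claim is trivial.
  by_cases hd : DifferentiableAt ℝ (fracInt μ g) t
  swap
  · rw [deriv_zero_of_not_differentiableAt hd]
  have hG : 0 < Real.Gamma (1 - μ) := Real.Gamma_pos_of_pos (by linarith)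
  -- Left difference quotients suffice: they are bounded above by M/Γ(1-μ) (t-τ)^{1-μ}, which tends
  -- to 0.
  have hslope := (hasDerivAt_iff_tendsto_slope.1 hd.hasDerivAt).mono_left
    (nhdsWithin_mono t (s := Iio t) (fun x (hx : x < t) => ne_of_lt hx))
  have hlim : Tendsto (fun τ => M / Real.Gamma (1 - μ) * (t - τ) ^ (1 - μ)) (𝓝[<] t) (𝓝 0) := by
    have hc : Continuous fun τ : ℝ => M / Real.Gamma (1 - μ) * (t - τ) ^ (1 - μ) :=
      continuous_const.mul ((continuous_const.sub continuous_id).rpow_const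
        fun _ => Or.inr (by linarith))
    have := (hc.tendsto t).mono_left (nhdsWithin_le_nhds (s := Iio t))
    simpa [Real.zero_rpow (by linarith : 1 - μ ≠ 0)] using this
  refine le_of_tendsto_of_tendsto hslope hlim ?_
  have hev : ∀ᶠ τ in 𝓝[<] t, τ ∈ Ioo (max 0 (t - δ)) t :=
    Ioo_mem_nhdsLT (max_lt ht.1 (by linarith))
  filter_upwards [hev] with τ hτ
  have hτ0 : 0 < τ := (le_max_left _ _).trans_lt hτ.1
  have hτδ : t - δ < τ := (le_max_right _ _).trans_lt hτ.1
  have hτt : τ < t := hτ.2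
  have I1 := hint t ⟨ht.1.le, ht.2.le⟩
  have I2 := hint τ ⟨hτ0.le, by linarith [ht.2]⟩
  have I1a : IntervalIntegrable (fun s => omega (1 - μ) (t - s) * g s) volume 0 τ :=
    I1.mono_set (by rw [uIcc_of_le hτ0.le, uIcc_of_le ht.1.le]; exact Icc_subset_Icc_right hτt.le)
  have I1b : IntervalIntegrable (fun s => omega (1 - μ) (t - s) * g s) volume τ t :=
    I1.mono_set (by rw [uIcc_of_le hτt.le, uIcc_of_le ht.1.le]; exact Icc_subset_Icc_left hτ0.le)
  have e1 : fracInt μ g t = (∫ s in (0 : ℝ)..τ, omega (1 - μ) (t - s) * g s)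
      + ∫ s in τ..t, omega (1 - μ) (t - s) * g s :=
    (intervalIntegral.integral_add_adjacent_intervals I1a I1b).symm
  -- The kernel decreases, so moving the endpoint from τ to t only lowers the contribution of the
  -- past.
  have e2 : (∫ s in (0 : ℝ)..τ, omega (1 - μ) (t - s) * g s) ≤ fracInt μ g τ := by
    refine intervalIntegral.integral_mono_on_of_le_Ioo hτ0.le I1a I2 fun s hs => ?_
    refine mul_le_mul_of_nonneg_right ?_ (hg s)
    unfold omega
    refine div_le_div_of_nonneg_right ?_ hG.le
    exact Real.rpow_le_rpow_of_nonpos (by linarith [hs.2]) (by linarith) (by linarith)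
  -- On the new piece (τ,t) the linear decay of `g` beats the singularity (t-s)^{-μ}.
  have e3 : (∫ s in τ..t, omega (1 - μ) (t - s) * g s)
      ≤ ∫ s in τ..t, M / Real.Gamma (1 - μ) * (t - τ) ^ (1 - μ) := by
    refine intervalIntegral.integral_mono_on_of_le_Ioo hτt.le I1b (by simp) fun s hs => ?_
    have hp : 0 < t - s := by linarith [hs.2]
    calc omega (1 - μ) (t - s) * g s ≤ omega (1 - μ) (t - s) * (M * (t - s)) :=
          mul_le_mul_of_nonneg_left (hgt s ⟨by linarith [hs.1], hs.2⟩) (omega_nonneg hμ1 hp.le)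
      _ = M / Real.Gamma (1 - μ) * (t - s) ^ (1 - μ) := by
          unfold omega
          rw [show (t - s) ^ (1 - μ) = (t - s) ^ (1 - μ - 1) * (t - s) by
            rw [← Real.rpow_add_one hp.ne']; ring_nf]
          ring
      _ ≤ _ := by
          refine mul_le_mul_of_nonneg_left ?_ (by positivity)
          exact Real.rpow_le_rpow hp.le (by linarith [hs.1]) (by linarith)
  rw [intervalIntegral.integral_const, smul_eq_mul] at e3
  rw [slope_comm, slope_def_field, div_le_iff₀ (by linarith)]
  linarith

lemma fracInt_nonneg (hμ1 : μ < 1) (hT : 0 ≤ T) (hg : ∀ s, 0 ≤ g s) : 0 ≤ fracInt μ g T :=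
  intervalIntegral.integral_nonneg hT fun s hs =>
    mul_nonneg (omega_nonneg hμ1 (by linarith [hs.2])) (hg s)

/-- The Riemann–Liouville derivative does not annihilate constants; this is the source of the weight
in the coercivity estimate. -/
lemma deriv_fracInt_one (hμ1 : μ < 1) {t : ℝ} (ht : 0 < t) :
    deriv (fracInt μ fun _ => 1) t = omega (1 - μ) t := by
  have : fracInt μ (fun _ => 1) = fun τ => τ ^ (1 - μ) / ((1 - μ) * Real.Gamma (1 - μ)) := by
    ext τ
    rw [← integral_omega hμ1]
    simp [fracInt, intervalIntegral.integral_comp_sub_left (fun s => omega (1 - μ) s)]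
  rw [this]
  have h1 : HasDerivAt (fun τ : ℝ => τ ^ (1 - μ)) ((1 - μ) * t ^ (1 - μ - 1)) t :=
    Real.hasDerivAt_rpow_const (Or.inl ht.ne')
  rw [(h1.div_const _).deriv, omega]
  have : 1 - μ ≠ 0 := by linarith
  field_simp

/-- The fractional analogue of `u u' = (u²)'/2`. -/
lemma mul_deriv_fracInt_ge (hS : S.Countable) (hμ0 : 0 < μ) (hμ1 : μ < 1) {u : ℝ → ℝ} {t L δ : ℝ}
    (ht : t ∈ Ioo 0 T \ S) (hδ : 0 < δ)
    (h1 : HasFracDeriv μ T S fun _ => 1) (hu : HasFracDeriv μ T S u)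
    (hu2 : HasFracDeriv μ T S fun s => u s ^ 2)
    (hL : ∀ s ∈ Ioo (t - δ) t, |u s - u t| ≤ L * (t - s)) :
    deriv (fracInt μ fun s => u s ^ 2) t / 2 + omega (1 - μ) t * u t ^ 2 / 2
      ≤ u t * deriv (fracInt μ u) t := by
  have hA := hu.const_mul (-2 * u t)
  have hB := h1.const_mul (u t ^ 2)
  have hAB := hA.add hS hB
  have hW : HasFracDeriv μ T S fun s => (u s - u t) ^ 2 := by
    have := hu2.add hS hAB
    convert this using 2 with s
    ring
  have hneg : deriv (fracInt μ fun s => (u s - u t) ^ 2) t ≤ 0 := by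
    -- Within the window t - s < δ, hence L²(t-s)² ≤ L²δ(t-s).
    refine deriv_fracInt_nonpos hμ0 hμ1 ht.1 hδ (M := L ^ 2 * δ) (by positivity) hW.integrable
      (fun s => sq_nonneg _) fun s hs => ?_
    have h2 : (u s - u t) ^ 2 ≤ (L * (t - s)) ^ 2 :=
      sq_le_sq' (by linarith [neg_abs_le (u s - u t), hL s hs]) (le_trans (le_abs_self _) (hL s hs))
    have h3 : 0 ≤ L ^ 2 * (t - s) := mul_nonneg (sq_nonneg _) (by linarith [hs.2])
    nlinarith [hs.1]
  -- Linearity applied to u² - 2u(t)u + u(t)², with u(t) frozen as a constant.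
  have e : deriv (fracInt μ fun s => (u s - u t) ^ 2) t
      = deriv (fracInt μ fun s => u s ^ 2) t
        + (-2 * u t * deriv (fracInt μ u) t + u t ^ 2 * omega (1 - μ) t) := by
    rw [← deriv_fracInt_one hμ1 ht.1.1, ← deriv_fracInt_const_mul, ← deriv_fracInt_const_mul,
      ← hA.deriv_add hB ht, ← hu2.deriv_add hAB ht]
    congr 2
    ext s; ring
  linarith

/-! ### Finite element functions: Lipschitz bounds, bilinear forms and the Poincaré inequality. -/

section Space

open scoped NNReal

/-- The neighbourhood may depend on `x`. Along the segment from x to y all right slopes of |v(γ r) -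
v(x)| are at most L‖y - x‖, and the mean value inequality integrates this bound. -/
lemma lipschitzWith_of_eventually_norm_sub_le {E : Type*} [NormedAddCommGroup E] [NormedSpace ℝ E]
    {v : E → ℝ} {L : ℝ≥0} (hv : Continuous v)
    (h : ∀ x, ∀ᶠ y in 𝓝 x, |v y - v x| ≤ L * ‖y - x‖) : LipschitzWith L v := by
  refine LipschitzWith.of_dist_le_mul fun y x => ?_
  rw [Real.dist_eq, dist_eq_norm]
  set γ : ℝ → E := fun r => x + r • (y - x) with hγ
  have hγc : Continuous γ := by fun_prop
  have key := image_le_of_liminf_slope_right_le_deriv_boundary (a := 0) (b := 1)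
    (f := fun r => |v (γ r) - v x|) (B := fun r => L * ‖y - x‖ * r)
    (B' := fun _ => L * ‖y - x‖) (by fun_prop) (by simp [hγ]) (by fun_prop)
    (fun r _ => by
      simpa using ((hasDerivAt_id r).const_mul (L * ‖y - x‖)).hasDerivWithinAt) ?_
    (right_mem_Icc.2 zero_le_one)
  · simpa [hγ] using key
  · intro r _ c hc
    have h1 : ∀ᶠ z in 𝓝[>] r, |v (γ z) - v (γ r)| ≤ L * ‖γ z - γ r‖ :=
      ((hγc.tendsto r).eventually (h (γ r))).filter_mono nhdsWithin_le_nhds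
    refine Eventually.frequently ?_
    filter_upwards [h1, self_mem_nhdsWithin] with z hz hzr
    have hzr : r < z := hzr
    have e : γ z - γ r = (z - r) • (y - x) := by simp only [hγ]; module
    rw [e, norm_smul, Real.norm_eq_abs, abs_of_pos (sub_pos.2 hzr)] at hz
    refine lt_of_le_of_lt ?_ hc
    rw [slope_def_field, div_le_iff₀ (by linarith)]
    have := abs_sub_abs_le_abs_sub (v (γ z) - v x) (v (γ r) - v x)
    rw [sub_sub_sub_cancel_right] at this
    linarith

lemma IsConvexPolytopalDomain.isOpen {d : ℕ} {Ω : Set (EuclideanSpace ℝ (Fin d))}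
    (h : IsConvexPolytopalDomain Ω) : IsOpen Ω := by
  obtain ⟨-, V, rfl⟩ := h
  exact isOpen_interior

lemma IsConvexPolytopalDomain.isBounded {d : ℕ} {Ω : Set (EuclideanSpace ℝ (Fin d))}
    (h : IsConvexPolytopalDomain Ω) : Bornology.IsBounded Ω := by
  obtain ⟨-, V, rfl⟩ := h
  exact ((isBounded_convexHull).2 V.finite_toSet.isBounded).subset interior_subset

variable {d : ℕ} {Ω : Set (EuclideanSpace ℝ (Fin d))}
  {K : Geometry.SimplicialComplex ℝ (EuclideanSpace ℝ (Fin d))}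

lemma feSpace_continuous (v : feSpace Ω K) : Continuous v.1 := v.2.1

lemma feSpace_eq_zero (v : feSpace Ω K) {x : EuclideanSpace ℝ (Fin d)} (hx : x ∉ Ω) : v.1 x = 0 :=
  v.2.2.1 x hx

lemma feSpace_hasCompactSupport (hΩ : Bornology.IsBounded Ω) (v : feSpace Ω K) :
    HasCompactSupport v.1 := by
  refine HasCompactSupport.intro (Metric.isCompact_of_isClosed_isBounded isClosed_closure
    hΩ.closure) fun x hx => feSpace_eq_zero v fun h => hx (subset_closure h)

/-- The simplices are closed and finitely many, so a simplex containing a point close enough to x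
contains x. The increment of v is then that of one affine piece; the sum of the norms of the linear
parts bounds every piece at once. -/
lemma feSpace_exists_lipschitzWith (ho : IsOpen Ω) (hK : IsTriangulation Ω K) (v : feSpace Ω K) :
    ∃ L : ℝ≥0, LipschitzWith L v.1 := by
  choose! p hp using v.2.2.2
  set F := hK.finite.toFinset with hF
  let l : Finset (EuclideanSpace ℝ (Fin d)) → (EuclideanSpace ℝ (Fin d) →L[ℝ] ℝ) :=
    fun s => (p s).linear.toContinuousLinearMap
  refine ⟨∑ s ∈ F, ‖l s‖₊, lipschitzWith_of_eventually_norm_sub_le (feSpace_continuous v)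
    fun x => ?_⟩
  have h1 : ∀ᶠ y in 𝓝 x, ∀ s ∈ F, y ∈ convexHull ℝ (s : Set (EuclideanSpace ℝ (Fin d))) →
      x ∈ convexHull ℝ (s : Set (EuclideanSpace ℝ (Fin d))) := by
    rw [Filter.eventually_all_finset]
    intro s _
    by_cases hx : x ∈ convexHull ℝ (s : Set (EuclideanSpace ℝ (Fin d)))
    · exact Eventually.of_forall fun _ _ => hx
    · have hc : IsClosed (convexHull ℝ (s : Set (EuclideanSpace ℝ (Fin d)))) :=
        s.finite_toSet.isClosed_convexHull (𝕜 := ℝ)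
      filter_upwards [hc.isOpen_compl.mem_nhds hx] with y hy h using absurd h hy
  have h2 : ∀ᶠ y in 𝓝 x, x ∈ Ω → y ∈ Ω := by
    by_cases hx : x ∈ Ω
    · filter_upwards [ho.mem_nhds hx] with y hy _ using hy
    · exact Eventually.of_forall fun _ h => absurd h hx
  filter_upwards [h1, h2] with y hy1 hy2
  by_cases hyc : y ∈ closure Ω
  · rw [← hK.space_eq, Geometry.SimplicialComplex.mem_space_iff] at hyc
    obtain ⟨s, hs, hys⟩ := hyc
    have hsF : s ∈ F := by simpa [hF] using hs
    have hxs := hy1 s hsF hys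
    rw [hp s hs y hys, hp s hs x hxs]
    have e : p s y - p s x = l s (y - x) := by
      simp only [l, LinearMap.coe_toContinuousLinearMap']
      rw [← vsub_eq_sub, ← vsub_eq_sub, AffineMap.linearMap_vsub]
    rw [e, ← Real.norm_eq_abs]
    refine ((l s).le_opNorm _).trans (mul_le_mul_of_nonneg_right ?_ (norm_nonneg _))
    have : ‖l s‖₊ ≤ ∑ s ∈ F, ‖l s‖₊ := Finset.single_le_sum (f := fun s => ‖l s‖₊) (fun _ _ => zero_le) hsF
    exact_mod_cast this
  -- Since Ω is open, x ∈ Ω would force y ∈ Ω; so both values are zero.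
  · have hyΩ : y ∉ Ω := fun h => hyc (subset_closure h)
    rw [feSpace_eq_zero v hyΩ, feSpace_eq_zero v fun h => hyΩ (hy2 h)]
    simp only [sub_self, abs_zero]
    positivity

/-- The values at the finitely many vertices determine a finite element function. -/
lemma feSpace_finiteDimensional (hK : IsTriangulation Ω K) : FiniteDimensional ℝ (feSpace Ω K) := by
  set V : Set (EuclideanSpace ℝ (Fin d)) := ⋃ s ∈ K.faces, (s : Set (EuclideanSpace ℝ (Fin d)))
  have hV : V.Finite := hK.finite.biUnion fun s _ => s.finite_toSet
  have := hV.to_subtype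
  let ev : feSpace Ω K →ₗ[ℝ] (V → ℝ) :=
    { toFun := fun v x => v.1 x
      map_add' := fun _ _ => rfl
      map_smul' := fun _ _ => rfl }
  refine Module.Finite.of_injective ev ((injective_iff_map_eq_zero ev).2 fun v hv => ?_)
  ext x
  by_cases hx : x ∈ Ω
  · have hx' : x ∈ closure Ω := subset_closure hx
    rw [← hK.space_eq, Geometry.SimplicialComplex.mem_space_iff] at hx'
    obtain ⟨s, hs, hxs⟩ := hx'
    obtain ⟨p, hp⟩ := v.2.2.2 s hs
    have hsub : convexHull ℝ (s : Set (EuclideanSpace ℝ (Fin d))) ⊆ p ⁻¹' {0} := by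
      refine convexHull_min (fun y hy => ?_) ((convex_singleton (0 : ℝ)).affine_preimage p)
      have hyV : y ∈ V := mem_biUnion hs hy
      have : v.1 y = 0 := congrFun hv ⟨y, hyV⟩
      rw [mem_preimage, ← hp y (subset_convexHull ℝ _ hy)]
      simpa using this
    rw [hp x hxs]
    simpa using hsub hxs
  · exact feSpace_eq_zero v hx

lemma feSpace_integrable_mul (hΩ : Bornology.IsBounded Ω) (v w : feSpace Ω K) :
    Integrable (fun x => v.1 x * w.1 x) :=
  ((feSpace_continuous v).mul (feSpace_continuous w)).integrable_of_hasCompactSupport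
    ((feSpace_hasCompactSupport hΩ v).mul_right)

lemma feSpace_memLp (hΩ : Bornology.IsBounded Ω) (v : feSpace Ω K) :
    MemLp v.1 2 (volume.restrict Ω) :=
  ((feSpace_continuous v).memLp_of_hasCompactSupport (feSpace_hasCompactSupport hΩ v)).restrict Ω

/-- The `L²(Ω)` inner product as a bilinear form on the finite element space. -/
noncomputable def l2Form (K : Geometry.SimplicialComplex ℝ (EuclideanSpace ℝ (Fin d)))
    (hΩ : Bornology.IsBounded Ω) : feSpace Ω K →ₗ[ℝ] feSpace Ω K →ₗ[ℝ] ℝ :=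
  LinearMap.mk₂ ℝ (fun v w => l2Inner Ω v.1 w.1)
    (fun v v' w => by
      unfold l2Inner
      rw [← integral_add (feSpace_integrable_mul hΩ v w).restrict
        (feSpace_integrable_mul hΩ v' w).restrict]
      congr 1; ext x; simp [add_mul])
    (fun c v w => by
      unfold l2Inner
      rw [smul_eq_mul, ← integral_const_mul]
      congr 1; ext x; simp [mul_assoc])
    (fun v w w' => by
      unfold l2Inner
      rw [← integral_add (feSpace_integrable_mul hΩ v w).restrict
        (feSpace_integrable_mul hΩ v w').restrict]
      congr 1; ext x; simp [mul_add])
    (fun c v w => by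
      unfold l2Inner
      rw [smul_eq_mul, ← integral_const_mul]
      congr 1; ext x; simp [mul_left_comm])

@[simp] lemma l2Form_apply (hΩ : Bornology.IsBounded Ω) (v w : feSpace Ω K) :
    l2Form K hΩ v w = l2Inner Ω v.1 w.1 := rfl

lemma measurable_gradient (v : EuclideanSpace ℝ (Fin d) → ℝ) : Measurable (gradient v) :=
  (InnerProductSpace.toDual ℝ _).symm.continuous.measurable.comp (measurable_fderiv ℝ v)

lemma norm_gradient (v : EuclideanSpace ℝ (Fin d) → ℝ) (x : EuclideanSpace ℝ (Fin d)) :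
    ‖gradient v x‖ = ‖fderiv ℝ v x‖ :=
  LinearIsometryEquiv.norm_map _ _

lemma isFiniteMeasure_restrict (hΩ : Bornology.IsBounded Ω) :
    IsFiniteMeasure (volume.restrict Ω) :=
  ⟨by simpa using hΩ.measure_lt_top⟩

lemma integrable_inner_gradient (ho : IsOpen Ω) (hΩ : Bornology.IsBounded Ω)
    (hK : IsTriangulation Ω K) (v w : feSpace Ω K) :
    Integrable (fun x => inner ℝ (gradient v.1 x) (gradient w.1 x)) (volume.restrict Ω) := by
  have := isFiniteMeasure_restrict hΩ
  obtain ⟨L, hL⟩ := feSpace_exists_lipschitzWith ho hK v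
  obtain ⟨L', hL'⟩ := feSpace_exists_lipschitzWith ho hK w
  refine Integrable.of_bound
    ((measurable_gradient v.1).inner (measurable_gradient w.1)).aestronglyMeasurable (L * L') ?_
  filter_upwards with x
  refine (norm_inner_le_norm _ _).trans ?_
  rw [norm_gradient, norm_gradient]
  exact mul_le_mul (norm_fderiv_le_of_lipschitz ℝ hL) (norm_fderiv_le_of_lipschitz ℝ hL')
    (norm_nonneg _) L.2

lemma integrable_norm_gradient_sq (ho : IsOpen Ω) (hΩ : Bornology.IsBounded Ω)
    (hK : IsTriangulation Ω K) (v : feSpace Ω K) :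
    Integrable (fun x => ‖gradient v.1 x‖ ^ 2) (volume.restrict Ω) := by
  simpa using integrable_inner_gradient ho hΩ hK v v

lemma ae_norm_le_norm_Lp_top {α : Type*} [MeasurableSpace α] {ν : Measure α} (φ : Lp ℝ ∞ ν) :
    ∀ᵐ x ∂ν, ‖φ x‖ ≤ ‖φ‖ := by
  have h := ae_le_eLpNormEssSup (f := φ) (μ := ν)
  filter_upwards [h] with x hx
  rw [Lp.norm_def, eLpNorm_exponent_top]
  have h2 : eLpNormEssSup φ ν ≠ ∞ := by
    have := Lp.eLpNorm_ne_top φ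
    rwa [eLpNorm_exponent_top] at this
  have := ENNReal.toReal_mono h2 hx
  simpa using this

lemma integrable_Lp_top_mul {α : Type*} [MeasurableSpace α] {ν : Measure α} (φ : Lp ℝ ∞ ν)
    {G : α → ℝ} (hG : Integrable G ν) : Integrable (fun x => φ x * G x) ν :=
  hG.bdd_mul (Lp.aestronglyMeasurable φ) (ae_norm_le_norm_Lp_top φ)

/-- Lipschitz with constant ‖G‖ in L¹. This turns continuity of the coefficient in time into
continuity of the stiffness form. -/
lemma continuous_integral_Lp_top_mul {α : Type*} [MeasurableSpace α] {ν : Measure α}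
    {G : α → ℝ} (hG : Integrable G ν) : Continuous fun φ : Lp ℝ ∞ ν => ∫ x, φ x * G x ∂ν := by
  refine (LipschitzWith.of_dist_le_mul (K := (∫ x, ‖G x‖ ∂ν).toNNReal)
    fun φ ψ => ?_).continuous
  rw [Real.dist_eq, ← Real.norm_eq_abs, dist_eq_norm, ← integral_sub (integrable_Lp_top_mul φ hG)
    (integrable_Lp_top_mul ψ hG), Real.coe_toNNReal _ (by positivity), mul_comm, ← integral_const_mul]
  refine norm_integral_le_of_norm_le (hG.norm.const_mul _) ?_
  filter_upwards [ae_norm_le_norm_Lp_top (φ - ψ), Lp.coeFn_sub φ ψ] with x h1 h2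
  rw [h2] at h1
  rw [← sub_mul, norm_mul]
  exact mul_le_mul_of_nonneg_right h1 (norm_nonneg _)

/-- Additivity needs both functions differentiable at x, which Rademacher's theorem gives almost
everywhere. -/
lemma ae_gradient_add (ho : IsOpen Ω) (hK : IsTriangulation Ω K) (v w : feSpace Ω K) :
    ∀ᵐ x ∂(volume.restrict Ω), gradient (v + w).1 x = gradient v.1 x + gradient w.1 x := by
  obtain ⟨L, hL⟩ := feSpace_exists_lipschitzWith ho hK v
  obtain ⟨L', hL'⟩ := feSpace_exists_lipschitzWith ho hK w
  filter_upwards [ae_restrict_of_ae hL.ae_differentiableAt, ae_restrict_of_ae hL'.ae_differentiableAt]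
    with x h1 h2
  have : (v + w).1 = fun x => v.1 x + w.1 x := rfl
  simp only [gradient, this]
  rw [fderiv_fun_add h1 h2, map_add]

lemma gradient_smul (c : ℝ) (v : feSpace Ω K) (x : EuclideanSpace ℝ (Fin d)) :
    gradient (c • v).1 x = c • gradient v.1 x := by
  have : (c • v).1 = c • v.1 := rfl
  simp only [gradient, this]
  rw [fderiv_const_smul_field, Pi.smul_apply, map_smul]

/-- The form `∫_Ω φ ∇v·∇w` as a bilinear form on the finite element space. -/
noncomputable def stiffnessForm (ho : IsOpen Ω) (hΩ : Bornology.IsBounded Ω)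
    (hK : IsTriangulation Ω K) (A : ℝ → Lp ℝ ∞ (volume.restrict Ω)) (s : ℝ) :
    feSpace Ω K →ₗ[ℝ] feSpace Ω K →ₗ[ℝ] ℝ :=
  LinearMap.mk₂ ℝ (fun v w => bilin Ω A s v.1 w.1)
    (fun v v' w => by
      unfold bilin
      rw [← integral_add (integrable_Lp_top_mul _ (integrable_inner_gradient ho hΩ hK v w))
        (integrable_Lp_top_mul _ (integrable_inner_gradient ho hΩ hK v' w))]
      refine integral_congr_ae ?_
      filter_upwards [ae_gradient_add ho hK v v'] with x hx
      rw [hx, inner_add_left, mul_add])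
    (fun c v w => by
      unfold bilin
      rw [smul_eq_mul, ← integral_const_mul]
      congr 1; ext x
      rw [gradient_smul, real_inner_smul_left]; ring)
    (fun v w w' => by
      unfold bilin
      rw [← integral_add (integrable_Lp_top_mul _ (integrable_inner_gradient ho hΩ hK v w))
        (integrable_Lp_top_mul _ (integrable_inner_gradient ho hΩ hK v w'))]
      refine integral_congr_ae ?_
      filter_upwards [ae_gradient_add ho hK w w'] with x hx
      rw [hx, inner_add_right, mul_add])
    (fun c v w => by
      unfold bilin
      rw [smul_eq_mul, ← integral_const_mul]
      congr 1; ext x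
      rw [gradient_smul, real_inner_smul_right]; ring)

@[simp] lemma stiffnessForm_apply (ho : IsOpen Ω) (hΩ : Bornology.IsBounded Ω)
    (hK : IsTriangulation Ω K) (A : ℝ → Lp ℝ ∞ (volume.restrict Ω)) (s : ℝ) (v w : feSpace Ω K) :
    stiffnessForm ho hΩ hK A s v w = bilin Ω A s v.1 w.1 := rfl

lemma continuousOn_bilin (ho : IsOpen Ω) (hΩ : Bornology.IsBounded Ω)
    (hK : IsTriangulation Ω K) {A : ℝ → Lp ℝ ∞ (volume.restrict Ω)} {I : Set ℝ}
    (hA : ContinuousOn A I) (v w : feSpace Ω K) :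
    ContinuousOn (fun s => bilin Ω A s v.1 w.1) I :=
  (continuous_integral_Lp_top_mul (integrable_inner_gradient ho hΩ hK v w)).comp_continuousOn hA

lemma mul_integral_norm_gradient_sq_le_bilin (ho : IsOpen Ω) (hΩ : Bornology.IsBounded Ω)
    (hK : IsTriangulation Ω K) {A : ℝ → Lp ℝ ∞ (volume.restrict Ω)} {T amin amax s : ℝ}
    (hA : IsDiffusivity Ω T amin amax A) (hs : s ∈ Icc 0 T) (v : feSpace Ω K) :
    amin * ∫ x in Ω, ‖gradient v.1 x‖ ^ 2 ≤ bilin Ω A s v.1 v.1 := by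
  rw [← integral_const_mul]
  refine integral_mono_ae ((integrable_norm_gradient_sq ho hΩ hK v).const_mul _)
    (integrable_Lp_top_mul _ (integrable_inner_gradient ho hΩ hK v v)) ?_
  filter_upwards [hA.lower s hs] with x hx
  simp only [real_inner_self_eq_norm_sq]
  exact mul_le_mul_of_nonneg_right hx.le (sq_nonneg _)

lemma lipschitzWith_sq_of_bounded {E : Type*} [PseudoMetricSpace E] {v : E → ℝ} {L : ℝ≥0} {M : ℝ≥0}
    (hL : LipschitzWith L v) (hM : ∀ x, |v x| ≤ M) : LipschitzWith (2 * M * L) fun x => v x ^ 2 := by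
  refine LipschitzWith.of_dist_le_mul fun x y => ?_
  have h1 := hL.dist_le_mul x y
  rw [Real.dist_eq] at h1 ⊢
  rw [sq_sub_sq, abs_mul]
  have h2 : |v x + v y| ≤ 2 * M := by linarith [abs_add_le (v x) (v y), hM x, hM y]
  push_cast
  calc _ ≤ (2 * M : ℝ) * (L * dist x y) := mul_le_mul h2 h1 (abs_nonneg _) (by positivity)
    _ = _ := by ring

/-- **Poincaré–Friedrichs inequality** for finite element functions, with a constant that only
depends on the domain. -/
lemma exists_poincare (hd : 1 ≤ d) (ho : IsOpen Ω) (hΩ : Bornology.IsBounded Ω) :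
    ∃ P : ℝ, 0 < P ∧ ∀ K : Geometry.SimplicialComplex ℝ (EuclideanSpace ℝ (Fin d)),
      IsTriangulation Ω K → ∀ v : feSpace Ω K,
        ∫ x in Ω, v.1 x ^ 2 ≤ P * ∫ x in Ω, ‖gradient v.1 x‖ ^ 2 := by
  obtain ⟨R, hR0, hR⟩ := hΩ.exists_pos_norm_le
  -- With |x_i| ≤ R on Ω, ∫v² = -2∫ x_i v ∂_i v ≤ ∫ (v²/2 + 2R²|∇v|²); absorbing half of ∫v² doubles
  -- 2R² to 4R².
  refine ⟨4 * R ^ 2, by positivity, fun K hK v => ?_⟩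
  obtain ⟨L, hL⟩ := feSpace_exists_lipschitzWith ho hK v
  have hc := feSpace_hasCompactSupport hΩ v
  obtain ⟨M, hM⟩ := hc.exists_bound_of_continuous (feSpace_continuous v)
  have hsq : LipschitzWith (2 * M.toNNReal * L) fun x => v.1 x ^ 2 :=
    lipschitzWith_sq_of_bounded hL fun x => (hM x).trans (Real.le_coe_toNNReal M)
  set i : Fin d := ⟨0, hd⟩
  set e : EuclideanSpace ℝ (Fin d) := EuclideanSpace.single i 1 with he
  let π : EuclideanSpace ℝ (Fin d) →L[ℝ] ℝ := EuclideanSpace.proj i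
  have hcs : HasCompactSupport fun x => v.1 x ^ 2 := by
    simp only [pow_two]
    exact hc.mul_right (f' := v.1)
  -- Integration by parts against the coordinate function `π`, of slope 1 along `e`. The extension
  -- by zero is Lipschitz with compact support on the whole space, so there is no boundary term.
  have hibp := LipschitzWith.integral_lineDeriv_mul_eq (μ := volume) π.lipschitz hsq hcs e
  have hne : ‖e‖ = 1 := by simp [he]
  have h1 : ∀ x, lineDeriv ℝ π x e = 1 := fun x => by
    rw [π.hasFDerivAt.hasLineDerivAt e |>.lineDeriv]
    simp [π, he]
  simp only [h1, one_mul] at hibp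
  have h2 : ∫ x in Ω, v.1 x ^ 2 = ∫ x, v.1 x ^ 2 :=
    setIntegral_eq_integral_of_forall_compl_eq_zero fun x hx => by simp [feSpace_eq_zero v hx]
  have iv : Integrable (fun x => v.1 x ^ 2) (volume.restrict Ω) := by
    simpa [pow_two] using (feSpace_integrable_mul hΩ v v).restrict
  have ig := integrable_norm_gradient_sq ho hΩ hK v
  have h3 : ∀ᵐ x, lineDeriv ℝ (fun x => v.1 x ^ 2) x (-e) * π x
      ≤ Ω.indicator (fun x => v.1 x ^ 2 / 2 + 2 * R ^ 2 * ‖gradient v.1 x‖ ^ 2) x := by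
    filter_upwards [hL.ae_differentiableAt] with x hx
    have hld : lineDeriv ℝ (fun x => v.1 x ^ 2) x (-e) = -(2 * v.1 x * fderiv ℝ v.1 x e) := by
      have := (hx.hasFDerivAt.pow 2).hasLineDerivAt (-e)
      rw [this.lineDeriv]
      simp
    rw [hld]
    by_cases hxΩ : x ∈ Ω
    · rw [indicator_of_mem hxΩ, norm_gradient]
      have hb : |fderiv ℝ v.1 x e| ≤ ‖fderiv ℝ v.1 x‖ := by
        simpa [hne] using (fderiv ℝ v.1 x).le_opNorm e
      have hp : |π x| ≤ R := (PiLp.norm_apply_le x i).trans (hR x hxΩ)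
      set G := ‖fderiv ℝ v.1 x‖
      have hbp : |fderiv ℝ v.1 x e * π x| ≤ G * R := by
        rw [abs_mul]
        exact mul_le_mul hb hp (abs_nonneg _) (norm_nonneg _)
      have hvb : -(v.1 x * (fderiv ℝ v.1 x e * π x)) ≤ |v.1 x| * (G * R) := by
        refine (neg_le_abs _).trans ?_
        rw [abs_mul]
        exact mul_le_mul_of_nonneg_left hbp (abs_nonneg _)
      have := sq_nonneg (|v.1 x| - 2 * R * G)
      nlinarith [sq_abs (v.1 x)]
    · rw [indicator_of_notMem hxΩ, feSpace_eq_zero v hxΩ]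
      simp
  have h4 : ∫ x, v.1 x ^ 2
      ≤ ∫ x, Ω.indicator (fun x => v.1 x ^ 2 / 2 + 2 * R ^ 2 * ‖gradient v.1 x‖ ^ 2) x := by
    -- A non-integrable integrand has integral 0 by default, and the upper bound is nonnegative.
    by_cases hi : Integrable fun x => lineDeriv ℝ (fun x => v.1 x ^ 2) x (-e) * π x
    · rw [hibp]
      exact integral_mono_ae hi
        ((integrable_indicator_iff ho.measurableSet).2 ((iv.div_const 2).add (ig.const_mul _))) h3
    · rw [hibp, integral_undef hi]
      refine integral_nonneg fun x => indicator_nonneg (fun x _ => by positivity) x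
  rw [integral_indicator ho.measurableSet, integral_add (iv.div_const 2) (ig.const_mul _),
    integral_div, integral_const_mul, ← h2] at h4
  linarith

end Space

/-! ### The basis in time and scalar coercivity. -/

section TimeMesh

variable {T μ : ℝ} {N : ℕ} {t : Fin (N + 1) → ℝ}

lemma IsTimeMesh.mem_Icc (ht : IsTimeMesh T t) (i : Fin (N + 1)) : t i ∈ Icc 0 T := by
  rw [← ht.first, ← ht.last]
  exact ⟨ht.strictMono.monotone (Fin.zero_le i), ht.strictMono.monotone (Fin.le_last i)⟩

lemma IsTimeMesh.timeInterval_subset (ht : IsTimeMesh T t) (n : Fin N) :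
    timeInterval t n ⊆ Ioo 0 T := fun _ hs =>
  ⟨(ht.mem_Icc n.castSucc).1.trans_lt hs.1, hs.2.trans_le (ht.mem_Icc n.succ).2⟩

lemma IsTimeMesh.eq_of_mem (ht : IsTimeMesh T t) {m n : Fin N} {s : ℝ}
    (hm : s ∈ timeInterval t m) (hn : s ∈ timeInterval t n) : m = n := by
  have key : ∀ {m n : Fin N}, s ∈ timeInterval t m → s ∈ timeInterval t n → ¬ m < n := by
    intro m n hm hn h
    have h1 : m.succ ≤ n.castSucc := by
      rw [Fin.le_def]; simpa using h
    have := ht.strictMono.monotone h1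
    linarith [hm.2, hn.1]
  exact le_antisymm (not_lt.1 (key hn hm)) (not_lt.1 (key hm hn))

lemma IsTimeMesh.notMem_range (ht : IsTimeMesh T t) {n : Fin N} {s : ℝ}
    (hs : s ∈ timeInterval t n) : s ∉ range t := by
  rintro ⟨i, rfl⟩
  have h1 := ht.strictMono.lt_iff_lt.1 hs.1
  have h2 := ht.strictMono.lt_iff_lt.1 hs.2
  rw [Fin.lt_def] at h1 h2
  simp at h1 h2
  omega

lemma IsTimeMesh.exists_mem (ht : IsTimeMesh T t) {s : ℝ} (hs : s ∈ Ioo 0 T \ range t) :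
    ∃ n, s ∈ timeInterval t n := by
  classical
  have hne : (Finset.univ.filter fun i => t i < s).Nonempty :=
    ⟨0, by simp [ht.first, hs.1.1]⟩
  set k := Finset.max' _ hne with hk
  have hkm : t k < s := by simpa using (Finset.mem_filter.1 (Finset.max'_mem _ hne)).2
  have hkl : k ≠ Fin.last N := by
    intro h
    rw [h, ht.last] at hkm
    linarith [hs.1.2]
  refine ⟨k.castPred hkl, by simpa using hkm, ?_⟩
  have h1 : ¬ t (k.castPred hkl).succ < s := by
    intro h
    have h2 := Finset.le_max' (Finset.univ.filter fun i => t i < s) (k.castPred hkl).succ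
      (by simpa using h)
    rw [← hk, Fin.le_def] at h2
    simp at h2
  exact lt_of_le_of_ne (not_lt.1 h1) fun h => hs.2 ⟨_, h.symm⟩

/-- The basis `1_{I_n}(s) s^i`, `i = 0, 1`, of the piecewise linear functions of time. -/
noncomputable def timeBasis (t : Fin (N + 1) → ℝ) (i : Fin N × Fin 2) : ℝ → ℝ :=
  (timeInterval t i.1).indicator fun s => s ^ (i.2 : ℕ)

/-- The Riemann–Liouville derivatives of the basis functions in time. -/
noncomputable def fracBasis (μ : ℝ) (t : Fin (N + 1) → ℝ) (i : Fin N × Fin 2) : ℝ → ℝ :=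
  deriv (fracInt μ (timeBasis t i))

/-- The linear combination `∑ i, φ i s • c i` as a linear map of the coefficients. -/
noncomputable def combo {ι : Type*} [Fintype ι] (V : Type*) [AddCommGroup V] [Module ℝ V]
    (φ : ι → ℝ → ℝ) (s : ℝ) : (ι → V) →ₗ[ℝ] V :=
  ∑ i, φ i s • LinearMap.proj i

lemma combo_apply {ι V : Type*} [Fintype ι] [AddCommGroup V] [Module ℝ V]
    (φ : ι → ℝ → ℝ) (s : ℝ) (c : ι → V) : combo V φ s c = ∑ i, φ i s • c i := by
  simp [combo]

lemma combo_timeBasis (ht : IsTimeMesh T t) {V : Type*} [AddCommGroup V] [Module ℝ V]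
    {n : Fin N} {s : ℝ} (hs : s ∈ timeInterval t n) (c : Fin N × Fin 2 → V) :
    combo V (timeBasis t) s c = c (n, 0) + s • c (n, 1) := by
  rw [combo_apply, Fintype.sum_prod_type, Finset.sum_eq_single n]
  · simp [timeBasis, hs]
  · intro m _ hm
    have : s ∉ timeInterval t m := fun h => hm (ht.eq_of_mem h hs)
    simp [timeBasis, this]
  · simp

lemma combo_timeBasis_eq_zero {V : Type*} [AddCommGroup V] [Module ℝ V]
    {s : ℝ} (c : Fin N × Fin 2 → V) (h : ∀ n, s ∈ timeInterval t n → c (n, 0) = 0 ∧ c (n, 1) = 0) :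
    combo V (timeBasis t) s c = 0 := by
  rw [combo_apply]
  refine Finset.sum_eq_zero fun ⟨m, j⟩ _ => ?_
  by_cases hm : s ∈ timeInterval t m
  · have : c (m, j) = 0 := by fin_cases j; exacts [(h m hm).1, (h m hm).2]
    rw [this, smul_zero]
  · simp [timeBasis, hm]

lemma measurable_timeBasis (i : Fin N × Fin 2) : Measurable (timeBasis t i) :=
  (measurable_id.pow_const _).indicator measurableSet_Ioo

lemma abs_timeBasis_le (ht : IsTimeMesh T t) (i : Fin N × Fin 2) (s : ℝ) :
    |timeBasis t i s| ≤ 1 + T := by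
  obtain ⟨n, j⟩ := i
  have hT : 0 ≤ T := (ht.mem_Icc 0).1.trans (ht.mem_Icc 0).2
  by_cases hs : s ∈ timeInterval t n
  · have h := ht.timeInterval_subset n hs
    have : |s| ≤ T := abs_le.2 ⟨by linarith [h.1], h.2.le⟩
    fin_cases j <;> simp [timeBasis, hs] <;> linarith
  · simp [timeBasis, hs]; linarith

lemma integrableOn_mul_timeBasis (ht : IsTimeMesh T t) {φ : ℝ → ℝ} {I : Set ℝ}
    (hφ : IntegrableOn φ I) (i : Fin N × Fin 2) :
    IntegrableOn (fun s => φ s * timeBasis t i s) I :=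
  hφ.mul_bdd (measurable_timeBasis i).aestronglyMeasurable
    (Eventually.of_forall fun s => abs_timeBasis_le ht i s)

lemma hasFracDeriv_timeBasis (hμ1 : μ < 1) (ht : IsTimeMesh T t) (i : Fin N × Fin 2) :
    HasFracDeriv μ T (range t) (timeBasis t i) :=
  hasFracDeriv_indicator_pow (countable_range t) hμ1 ((ht.mem_Icc 0).1.trans (ht.mem_Icc 0).2)
    (ht.mem_Icc _).1 (ht.strictMono (Fin.castSucc_lt_succ)).le (mem_range_self _)
    (mem_range_self _) _

lemma integrableOn_fracBasis (hμ1 : μ < 1) (ht : IsTimeMesh T t) (i : Fin N × Fin 2) :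
    IntegrableOn (fracBasis μ t i) (Ioo 0 T) :=
  (hasFracDeriv_timeBasis hμ1 ht i).integrableOn_deriv

lemma integrableOn_timeBasis (ht : IsTimeMesh T t) (i : Fin N × Fin 2) :
    IntegrableOn (timeBasis t i) (Ioo 0 T) := by
  simpa using integrableOn_mul_timeBasis ht (φ := fun _ => 1) (I := Ioo 0 T) (by simp) i

/-- Needed for u². A product is again a monomial on one interval, or zero when the intervals differ.
-/
lemma hasFracDeriv_timeBasis_mul (hμ1 : μ < 1) (ht : IsTimeMesh T t) (i j : Fin N × Fin 2) :
    HasFracDeriv μ T (range t) fun s => timeBasis t i s * timeBasis t j s := by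
  by_cases h : i.1 = j.1
  · have : (fun s => timeBasis t i s * timeBasis t j s) =
        (timeInterval t i.1).indicator fun s => s ^ ((i.2 : ℕ) + j.2) := by
      ext s
      by_cases hs : s ∈ timeInterval t i.1
      · have hs' := hs
        rw [h] at hs'
        simp [timeBasis, hs, hs', pow_add]
      · simp [timeBasis, hs]
    rw [this]
    exact hasFracDeriv_indicator_pow (countable_range t) hμ1
      ((ht.mem_Icc 0).1.trans (ht.mem_Icc 0).2) (ht.mem_Icc _).1
      (ht.strictMono (Fin.castSucc_lt_succ)).le (mem_range_self _) (mem_range_self _) _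
  · have : (fun s => timeBasis t i s * timeBasis t j s) = fun _ => 0 := by
      ext s
      by_cases hs : s ∈ timeInterval t i.1
      · have : s ∉ timeInterval t j.1 := fun h' => h (ht.eq_of_mem hs h')
        simp [timeBasis, this]
      · simp [timeBasis, hs]
    rw [this]
    exact HasFracDeriv.zero

lemma hasFracDeriv_one (hμ1 : μ < 1) (ht : IsTimeMesh T t) :
    HasFracDeriv μ T (range t) fun _ => 1 := by
  have hT : 0 ≤ T := (ht.mem_Icc 0).1.trans (ht.mem_Icc 0).2
  refine (hasFracDeriv_indicator_pow (countable_range t) hμ1 hT le_rfl hT ⟨0, ht.first⟩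
    ⟨_, ht.last⟩ 0).congr_ae (Eventually.of_forall fun s hs => ?_)
  simp only [indicator_of_mem hs, pow_zero]

/-- Coercivity of the Riemann–Liouville derivative on scalar piecewise linear functions. -/
lemma integral_fracBasis_coercive (hμ0 : 0 < μ) (hμ1 : μ < 1) (ht : IsTimeMesh T t)
    (c : Fin N × Fin 2 → ℝ) :
    0 ≤ ∫ s in Ioo 0 T, (combo ℝ (fracBasis μ t) s c * combo ℝ (timeBasis t) s c
      - omega (1 - μ) s / 2 * (combo ℝ (timeBasis t) s c * combo ℝ (timeBasis t) s c)) := by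
  have hT : 0 ≤ T := (ht.mem_Icc 0).1.trans (ht.mem_Icc 0).2
  have hS : (range t).Countable := countable_range t
  set u : ℝ → ℝ := fun s => combo ℝ (timeBasis t) s c with hu
  have hus : u = fun s => ∑ i, c i * timeBasis t i s := by
    ext s; simp [hu, combo_apply, mul_comm]
  have hterm : ∀ i ∈ (Finset.univ : Finset (Fin N × Fin 2)),
      HasFracDeriv μ T (range t) fun s => c i * timeBasis t i s :=
    fun i _ => (hasFracDeriv_timeBasis hμ1 ht i).const_mul (c i)
  have huF : HasFracDeriv μ T (range t) u := by
    rw [hus]; exact HasFracDeriv.sum hS _ hterm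
  have huD : ∀ s ∈ Ioo 0 T \ range t, deriv (fracInt μ u) s = combo ℝ (fracBasis μ t) s c := by
    intro s hs
    rw [hus, HasFracDeriv.deriv_sum hS _ hterm hs, combo_apply]
    refine Finset.sum_congr rfl fun i _ => ?_
    rw [deriv_fracInt_const_mul, smul_eq_mul, mul_comm]; rfl
  have hu2 : HasFracDeriv μ T (range t) fun s => u s ^ 2 := by
    have : (fun s => u s ^ 2) =
        fun s => ∑ i, ∑ j, (c i * c j) * (timeBasis t i s * timeBasis t j s) := by
      ext s
      simp only [hus]
      rw [pow_two, Finset.sum_mul_sum]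
      exact Finset.sum_congr rfl fun i _ => Finset.sum_congr rfl fun j _ => by ring
    rw [this]
    exact HasFracDeriv.sum hS _ fun i _ => HasFracDeriv.sum hS _ fun j _ =>
      (hasFracDeriv_timeBasis_mul hμ1 ht i j).const_mul _
  have hI1 : IntegrableOn (fun s => combo ℝ (fracBasis μ t) s c * u s) (Ioo 0 T) := by
    have : (fun s => combo ℝ (fracBasis μ t) s c * u s) = fun s =>
        ∑ i, ∑ j, (c i * c j) * (fracBasis μ t i s * timeBasis t j s) := by
      ext s
      simp only [hus, combo_apply]
      rw [Finset.sum_mul_sum]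
      exact Finset.sum_congr rfl fun i _ => Finset.sum_congr rfl fun j _ => by
        rw [smul_eq_mul]; ring
    rw [this]
    exact integrable_finsetSum _ fun i _ => integrable_finsetSum _ fun j _ =>
      (integrableOn_mul_timeBasis ht (integrableOn_fracBasis hμ1 ht i) j).const_mul _
  have hI2 : IntegrableOn (fun s => omega (1 - μ) s / 2 * (u s * u s)) (Ioo 0 T) := by
    have : (fun s => omega (1 - μ) s / 2 * (u s * u s)) = fun s =>
        ∑ i, ∑ j, (c i * c j / 2) * (omega (1 - μ) s * timeBasis t i s * timeBasis t j s) := by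
      ext s
      simp only [hus]
      rw [Finset.sum_mul_sum, Finset.mul_sum]
      refine Finset.sum_congr rfl fun i _ => ?_
      rw [Finset.mul_sum]
      exact Finset.sum_congr rfl fun j _ => by ring
    rw [this]
    exact integrable_finsetSum _ fun i _ => integrable_finsetSum _ fun j _ =>
      (integrableOn_mul_timeBasis ht
        (integrableOn_mul_timeBasis ht (integrableOn_omega hμ1 hT) i) j).const_mul _
  -- The integral of D^μ(u²) is the fractional integral of u² at `T`, where kernel and integrand are
  -- nonnegative.
  have h0 : 0 ≤ ∫ s in Ioo 0 T, deriv (fracInt μ fun s => u s ^ 2) s / 2 := by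
    rw [integral_div, hu2.integral_deriv hS hT]
    exact div_nonneg (fracInt_nonneg hμ1 hT fun s => sq_nonneg _) zero_le_two
  refine h0.trans (integral_mono_ae (hu2.integrableOn_deriv.div_const 2) (hI1.sub hI2) ?_)
  filter_upwards [ae_restrict_Ioo_diff hS] with s hs
  obtain ⟨n, hn⟩ := ht.exists_mem hs
  -- The window reaches back to the left end of the interval containing `s`; there `u` is affine
  -- with slope `c (n, 1)`.
  have hlip : ∀ r ∈ Ioo (s - (s - t n.castSucc)) s, |u r - u s| ≤ |c (n, 1)| * (s - r) := by
    intro r hr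
    have hr' : r ∈ timeInterval t n := ⟨by linarith [hr.1], hr.2.trans hn.2⟩
    simp only [hu, combo_timeBasis ht hr', combo_timeBasis ht hn, smul_eq_mul]
    rw [← abs_of_pos (sub_pos.2 hr.2), ← abs_mul, ← abs_neg]
    apply le_of_eq
    congr 1; ring
  have := mul_deriv_fracInt_ge hS hμ0 hμ1 hs (sub_pos.2 hn.1) (hasFracDeriv_one hμ1 ht) huF hu2 hlip
  rw [huD s hs] at this
  change _ ≤ combo ℝ (fracBasis μ t) s c * u s - omega (1 - μ) s / 2 * (u s * u s)
  linarith

lemma combo_form_expand {ι V : Type*} [Fintype ι] [AddCommGroup V] [Module ℝ V]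
    (b : V →ₗ[ℝ] V →ₗ[ℝ] ℝ) (φ ψ : ι → ℝ → ℝ) (s : ℝ) (c e : ι → V) :
    b (combo V φ s c) (combo V ψ s e) = ∑ i, ∑ j, φ i s * ψ j s * b (c i) (e j) := by
  simp only [combo_apply, map_sum, LinearMap.sum_apply, map_smul, LinearMap.smul_apply, smul_eq_mul,
    Finset.mul_sum]
  rw [Finset.sum_comm]
  exact Finset.sum_congr rfl fun i _ =>
    Finset.sum_congr rfl fun j _ => by ring

lemma integrableOn_form_combo {ι V : Type*} [Fintype ι] [AddCommGroup V] [Module ℝ V]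
    {b : ℝ → V →ₗ[ℝ] V →ₗ[ℝ] ℝ} {φ ψ : ι → ℝ → ℝ}
    (hb : ∀ v w, ContinuousOn (fun s => b s v w) (Icc 0 T))
    (h : ∀ i j, IntegrableOn (fun s => φ i s * ψ j s) (Ioo 0 T)) (c e : ι → V) :
    IntegrableOn (fun s => b s (combo V φ s c) (combo V ψ s e)) (Ioo 0 T) := by
  simp only [combo_form_expand]
  refine integrable_finsetSum _ fun i _ => integrable_finsetSum _ fun j _ => ?_
  obtain ⟨M, hM⟩ := isCompact_Icc.exists_bound_of_continuousOn (hb (c i) (e j))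
  refine (h i j).mul_bdd (c := M)
    (((hb (c i) (e j)).mono Ioo_subset_Icc_self).aestronglyMeasurable measurableSet_Ioo) ?_
  filter_upwards [ae_restrict_mem measurableSet_Ioo] with s hs
  exact hM s (Ioo_subset_Icc_self hs)

/-- The weights of the quadratic form in `integral_fracBasis_coercive`. -/
noncomputable def coerciveWeight (μ T : ℝ) (t : Fin (N + 1) → ℝ) (i j : Fin N × Fin 2) : ℝ :=
  ∫ s in Ioo 0 T, (fracBasis μ t i s - omega (1 - μ) s / 2 * timeBasis t i s) * timeBasis t j s

/-- The weights depend neither on `b` nor on `V`, so scalar coercivity is positivity of a fixed real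
quadratic form that can be reused for S_h-valued coefficients. -/
lemma integral_form_eq_sum_coerciveWeight (hμ1 : μ < 1) (ht : IsTimeMesh T t) {V : Type*}
    [AddCommGroup V] [Module ℝ V] (b : V →ₗ[ℝ] V →ₗ[ℝ] ℝ) (c : Fin N × Fin 2 → V) :
    ∫ s in Ioo 0 T, (b (combo V (fracBasis μ t) s c) (combo V (timeBasis t) s c)
      - omega (1 - μ) s / 2 * b (combo V (timeBasis t) s c) (combo V (timeBasis t) s c))
      = ∑ i, ∑ j, coerciveWeight μ T t i j * b (c i) (c j) := by
  have hT : 0 ≤ T := (ht.mem_Icc 0).1.trans (ht.mem_Icc 0).2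
  have hI : ∀ i j, IntegrableOn (fun s =>
      (fracBasis μ t i s - omega (1 - μ) s / 2 * timeBasis t i s) * timeBasis t j s) (Ioo 0 T) :=
    fun i j => integrableOn_mul_timeBasis ht ((integrableOn_fracBasis hμ1 ht i).sub
      (integrableOn_mul_timeBasis ht ((integrableOn_omega hμ1 hT).div_const 2) i)) j
  have e : ∀ s, (b (combo V (fracBasis μ t) s c) (combo V (timeBasis t) s c)
      - omega (1 - μ) s / 2 * b (combo V (timeBasis t) s c) (combo V (timeBasis t) s c))
      = ∑ i, ∑ j, (fracBasis μ t i s - omega (1 - μ) s / 2 * timeBasis t i s) * timeBasis t j s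
          * b (c i) (c j) := by
    intro s
    simp only [combo_form_expand, Finset.mul_sum, ← Finset.sum_sub_distrib]
    exact Finset.sum_congr rfl fun i _ => Finset.sum_congr rfl fun j _ => by ring
  simp only [e]
  rw [integral_finsetSum _ fun i _ => integrable_finsetSum _ fun j _ => (hI i j).mul_const _]
  refine Finset.sum_congr rfl fun i _ => ?_
  rw [integral_finsetSum _ fun j _ => (hI i j).mul_const _]
  exact Finset.sum_congr rfl fun j _ => integral_mul_const _ _

end TimeMesh

/-! ### The scheme as a bilinear form and a functional on coefficients. -/

section Scheme

variable {d N : ℕ} {Ω : Set (EuclideanSpace ℝ (Fin d))}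
  {K : Geometry.SimplicialComplex ℝ (EuclideanSpace ℝ (Fin d))} {T μ : ℝ} {t : Fin (N + 1) → ℝ}

/-- Coercivity of the Riemann–Liouville derivative on discontinuous Galerkin functions. -/
lemma integral_l2Form_coercive (hΩ : Bornology.IsBounded Ω) (hμ0 : 0 < μ) (hμ1 : μ < 1)
    (ht : IsTimeMesh T t) (c : Fin N × Fin 2 → feSpace Ω K) :
    0 ≤ ∫ s in Ioo 0 T, (l2Form K hΩ (combo _ (fracBasis μ t) s c) (combo _ (timeBasis t) s c)
      - omega (1 - μ) s / 2 * l2Form K hΩ (combo _ (timeBasis t) s c) (combo _ (timeBasis t) s c)) := by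
  rw [integral_form_eq_sum_coerciveWeight hμ1 ht]
  simp only [l2Form_apply, l2Inner, ← integral_const_mul]
  have hI : ∀ i j, Integrable (fun x => coerciveWeight μ T t i j * ((c i).1 x * (c j).1 x))
      (volume.restrict Ω) := fun i j => (feSpace_integrable_mul hΩ (c i) (c j)).restrict.const_mul _
  have e : ∑ i, ∑ j, ∫ x in Ω, coerciveWeight μ T t i j * ((c i).1 x * (c j).1 x)
      = ∫ x in Ω, ∑ i, ∑ j, coerciveWeight μ T t i j * ((c i).1 x * (c j).1 x) := by
    rw [integral_finsetSum _ fun i _ => integrable_finsetSum _ fun j _ => hI i j]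
    refine Finset.sum_congr rfl fun i _ => ?_
    rw [integral_finsetSum _ fun j _ => hI i j]
  rw [e]
  -- At a fixed x the coefficients are real numbers, and scalar coercivity applies.
  refine integral_nonneg fun x => ?_
  have h1 := integral_fracBasis_coercive hμ0 hμ1 ht fun i => (c i).1 x
  have h2 := integral_form_eq_sum_coerciveWeight hμ1 ht (LinearMap.mul ℝ ℝ) fun i => (c i).1 x
  simp only [LinearMap.mul_apply'] at h2
  rwa [h2] at h1

/-- The embedding of the finite element space into `L²(Ω)`. -/
noncomputable def toL2 (K : Geometry.SimplicialComplex ℝ (EuclideanSpace ℝ (Fin d)))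
    (hΩ : Bornology.IsBounded Ω) : feSpace Ω K →ₗ[ℝ] Lp ℝ 2 (volume.restrict Ω) where
  toFun v := (feSpace_memLp hΩ v).toLp v.1
  map_add' _ _ := rfl
  map_smul' _ _ := rfl

lemma coeFn_toL2 (hΩ : Bornology.IsBounded Ω) (v : feSpace Ω K) :
    toL2 K hΩ v =ᵐ[volume.restrict Ω] v.1 :=
  (feSpace_memLp hΩ v).coeFn_toLp

lemma inner_toL2 (hΩ : Bornology.IsBounded Ω) (g : Lp ℝ 2 (volume.restrict Ω)) (v : feSpace Ω K) :
    inner ℝ g (toL2 K hΩ v) = ∫ x in Ω, g x * v.1 x := by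
  rw [L2.inner_def]
  refine integral_congr_ae ?_
  filter_upwards [coeFn_toL2 hΩ v] with x hx
  rw [hx]
  simp [mul_comm]

lemma norm_toL2_sq (hΩ : Bornology.IsBounded Ω) (v : feSpace Ω K) :
    ‖toL2 K hΩ v‖ ^ 2 = l2Inner Ω v.1 v.1 := by
  rw [← real_inner_self_eq_norm_sq, inner_toL2, l2Inner]
  refine integral_congr_ae ?_
  filter_upwards [coeFn_toL2 hΩ v] with x hx
  rw [hx]

lemma integrable_Lp_mul_feSpace (hΩ : Bornology.IsBounded Ω) (g : Lp ℝ 2 (volume.restrict Ω))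
    (v : feSpace Ω K) : Integrable (fun x => g x * v.1 x) (volume.restrict Ω) :=
  (Lp.memLp g).integrable_mul (feSpace_memLp hΩ v)

/-- The right-hand side functional `v ↦ ⟨f(s) + ω_{1-μ}(s) U0, v⟩`. -/
noncomputable def loadForm (K : Geometry.SimplicialComplex ℝ (EuclideanSpace ℝ (Fin d)))
    (hΩ : Bornology.IsBounded Ω) (μ : ℝ) (U0 : Lp ℝ 2 (volume.restrict Ω))
    (f : ℝ → Lp ℝ 2 (volume.restrict Ω)) (s : ℝ) : feSpace Ω K →ₗ[ℝ] ℝ :=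
  (innerSL ℝ (f s + omega (1 - μ) s • U0)).toLinearMap ∘ₗ toL2 K hΩ

lemma loadForm_apply (hΩ : Bornology.IsBounded Ω) (U0 : Lp ℝ 2 (volume.restrict Ω))
    (f : ℝ → Lp ℝ 2 (volume.restrict Ω)) (s : ℝ) (v : feSpace Ω K) :
    loadForm K hΩ μ U0 f s v
      = inner ℝ (f s) (toL2 K hΩ v) + omega (1 - μ) s * inner ℝ U0 (toL2 K hΩ v) := by
  change inner ℝ (f s + omega (1 - μ) s • U0) (toL2 K hΩ v) = _
  rw [inner_add_left, real_inner_smul_left]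

lemma loadForm_eq_l2Inner (hΩ : Bornology.IsBounded Ω) (U0 : Lp ℝ 2 (volume.restrict Ω))
    (f : ℝ → Lp ℝ 2 (volume.restrict Ω)) (s : ℝ) (v : feSpace Ω K) :
    l2Inner Ω (fun x => f s x + omega (1 - μ) s * U0 x) v.1 = loadForm K hΩ μ U0 f s v := by
  rw [loadForm_apply, inner_toL2, inner_toL2, l2Inner, ← integral_const_mul,
    ← integral_add (integrable_Lp_mul_feSpace hΩ _ v) ((integrable_Lp_mul_feSpace hΩ _ v).const_mul _)]
  congr 1; ext x; ring

lemma integrableOn_loadForm (hΩ : Bornology.IsBounded Ω) (hμ1 : μ < 1) (ht : IsTimeMesh T t)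
    (U0 : Lp ℝ 2 (volume.restrict Ω)) {f : ℝ → Lp ℝ 2 (volume.restrict Ω)}
    (hf : MemLp f 2 (volume.restrict (Ioo 0 T))) (e : Fin N × Fin 2 → feSpace Ω K) :
    IntegrableOn (fun s => loadForm K hΩ μ U0 f s (combo _ (timeBasis t) s e)) (Ioo 0 T) := by
  have hT : 0 ≤ T := (ht.mem_Icc 0).1.trans (ht.mem_Icc 0).2
  have hfi : Integrable f (volume.restrict (Ioo 0 T)) := hf.integrable one_le_two
  have h1 : ∀ v : feSpace Ω K, IntegrableOn (fun s => loadForm K hΩ μ U0 f s v) (Ioo 0 T) := by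
    intro v
    simp only [loadForm_apply]
    exact (hfi.inner_const _).add ((integrableOn_omega hμ1 hT).mul_const _)
  have e1 : ∀ s, loadForm K hΩ μ U0 f s (combo _ (timeBasis t) s e)
      = ∑ i, loadForm K hΩ μ U0 f s (e i) * timeBasis t i s := fun s => by
    simp [combo_apply, mul_comm]
  simp only [e1]
  exact integrable_finsetSum _ fun i _ => integrableOn_mul_timeBasis ht (h1 (e i)) i

/-- The right-hand side of the scheme, summed over the time intervals. -/
noncomputable def loadFunctional (hΩ : Bornology.IsBounded Ω) (hμ1 : μ < 1) (ht : IsTimeMesh T t)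
    (U0 : Lp ℝ 2 (volume.restrict Ω)) {f : ℝ → Lp ℝ 2 (volume.restrict Ω)}
    (hf : MemLp f 2 (volume.restrict (Ioo 0 T))) :
    (Fin N × Fin 2 → feSpace Ω K) →ₗ[ℝ] ℝ where
  toFun e := ∫ s in Ioo 0 T, loadForm K hΩ μ U0 f s (combo _ (timeBasis t) s e)
  map_add' e e' := by
    rw [← integral_add (integrableOn_loadForm hΩ hμ1 ht U0 hf e)
      (integrableOn_loadForm hΩ hμ1 ht U0 hf e')]
    simp only [map_add]
  map_smul' r e := by
    simp only [map_smul, smul_eq_mul, integral_const_mul, RingHom.id_apply]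

/-- The integrand of the left-hand side of the scheme in terms of coefficients. -/
noncomputable def schemeIntegrand (μ : ℝ) (t : Fin (N + 1) → ℝ) (ho : IsOpen Ω)
    (hΩ : Bornology.IsBounded Ω) (hK : IsTriangulation Ω K)
    (A : ℝ → Lp ℝ ∞ (volume.restrict Ω)) (s : ℝ) :
    (Fin N × Fin 2 → feSpace Ω K) →ₗ[ℝ] (Fin N × Fin 2 → feSpace Ω K) →ₗ[ℝ] ℝ :=
  (l2Form K hΩ).compl₁₂ (combo _ (fracBasis μ t) s) (combo _ (timeBasis t) s)
    + (stiffnessForm ho hΩ hK A s).compl₁₂ (combo _ (timeBasis t) s) (combo _ (timeBasis t) s)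

lemma schemeIntegrand_apply (ho : IsOpen Ω)
    (hΩ : Bornology.IsBounded Ω) (hK : IsTriangulation Ω K)
    (A : ℝ → Lp ℝ ∞ (volume.restrict Ω)) (s : ℝ) (c e : Fin N × Fin 2 → feSpace Ω K) :
    schemeIntegrand μ t ho hΩ hK A s c e
      = l2Form K hΩ (combo _ (fracBasis μ t) s c) (combo _ (timeBasis t) s e)
        + stiffnessForm ho hΩ hK A s (combo _ (timeBasis t) s c) (combo _ (timeBasis t) s e) := rfl

lemma integrableOn_l2Form_fracBasis (hΩ : Bornology.IsBounded Ω) (hμ1 : μ < 1)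
    (ht : IsTimeMesh T t) (c e : Fin N × Fin 2 → feSpace Ω K) :
    IntegrableOn (fun s => l2Form K hΩ (combo _ (fracBasis μ t) s c) (combo _ (timeBasis t) s e))
      (Ioo 0 T) :=
  integrableOn_form_combo (b := fun _ => l2Form K hΩ) (fun _ _ => continuousOn_const)
    (fun i j => integrableOn_mul_timeBasis ht (integrableOn_fracBasis hμ1 ht i) j) c e

lemma integrableOn_stiffnessForm (ho : IsOpen Ω) (hΩ : Bornology.IsBounded Ω)
    (hK : IsTriangulation Ω K) (ht : IsTimeMesh T t) {A : ℝ → Lp ℝ ∞ (volume.restrict Ω)}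
    (hA : ContinuousOn A (Icc 0 T)) (c e : Fin N × Fin 2 → feSpace Ω K) :
    IntegrableOn (fun s => stiffnessForm ho hΩ hK A s (combo _ (timeBasis t) s c)
      (combo _ (timeBasis t) s e)) (Ioo 0 T) :=
  integrableOn_form_combo (b := stiffnessForm ho hΩ hK A) (continuousOn_bilin ho hΩ hK hA)
    (fun i j => integrableOn_mul_timeBasis ht (integrableOn_timeBasis ht i) j) c e

lemma integrableOn_schemeIntegrand (ho : IsOpen Ω) (hΩ : Bornology.IsBounded Ω)
    (hK : IsTriangulation Ω K) (hμ1 : μ < 1) (ht : IsTimeMesh T t)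
    {A : ℝ → Lp ℝ ∞ (volume.restrict Ω)}
    (hA : ContinuousOn A (Icc 0 T)) (c e : Fin N × Fin 2 → feSpace Ω K) :
    IntegrableOn (fun s => schemeIntegrand μ t ho hΩ hK A s c e) (Ioo 0 T) :=
  (integrableOn_l2Form_fracBasis hΩ hμ1 ht c e).add (integrableOn_stiffnessForm ho hΩ hK ht hA c e)

/-- The left-hand side of the scheme, summed over the time intervals. -/
noncomputable def schemeForm (ho : IsOpen Ω) (hΩ : Bornology.IsBounded Ω)
    (hK : IsTriangulation Ω K) (hμ1 : μ < 1) (ht : IsTimeMesh T t)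
    {A : ℝ → Lp ℝ ∞ (volume.restrict Ω)} (hA : ContinuousOn A (Icc 0 T)) :
    (Fin N × Fin 2 → feSpace Ω K) →ₗ[ℝ] (Fin N × Fin 2 → feSpace Ω K) →ₗ[ℝ] ℝ :=
  LinearMap.mk₂ ℝ (fun c e => ∫ s in Ioo 0 T, schemeIntegrand μ t ho hΩ hK A s c e)
    (fun c c' e => by
      rw [← integral_add (integrableOn_schemeIntegrand ho hΩ hK hμ1 ht hA c e)
        (integrableOn_schemeIntegrand ho hΩ hK hμ1 ht hA c' e)]
      simp only [map_add, LinearMap.add_apply])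
    (fun r c e => by
      simp only [map_smul, LinearMap.smul_apply, smul_eq_mul, integral_const_mul])
    (fun c e e' => by
      rw [← integral_add (integrableOn_schemeIntegrand ho hΩ hK hμ1 ht hA c e)
        (integrableOn_schemeIntegrand ho hΩ hK hμ1 ht hA c e')]
      simp only [map_add])
    (fun r c e => by
      simp only [map_smul, smul_eq_mul, integral_const_mul])

end Scheme

/-! ### Energy estimate, injectivity and the equivalent linear system. -/

section Stability

variable {d N : ℕ} {Ω : Set (EuclideanSpace ℝ (Fin d))}
  {K : Geometry.SimplicialComplex ℝ (EuclideanSpace ℝ (Fin d))} {T μ : ℝ} {t : Fin (N + 1) → ℝ}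

lemma integrableOn_norm_gradient_sq_combo (ho : IsOpen Ω) (hΩ : Bornology.IsBounded Ω)
    (hK : IsTriangulation Ω K) (ht : IsTimeMesh T t) (c : Fin N × Fin 2 → feSpace Ω K) :
    IntegrableOn (fun s => ∫ x in Ω, ‖gradient (combo _ (timeBasis t) s c).1 x‖ ^ 2) (Ioo 0 T) := by
  have := isFiniteMeasure_restrict hΩ
  -- The squared gradient norm is the stiffness form with coefficient 1 and inherits its
  -- integrability.
  let φ : Lp ℝ ∞ (volume.restrict Ω) := (memLp_const (1 : ℝ)).toLp (fun _ => (1 : ℝ))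
  have hφ : ∀ᵐ x ∂(volume.restrict Ω), φ x = 1 := (memLp_const (1 : ℝ)).coeFn_toLp
  have h := integrableOn_stiffnessForm ho hΩ hK ht (A := fun _ => φ) continuousOn_const c c
  have e : ∀ s (v : feSpace Ω K), stiffnessForm ho hΩ hK (fun _ => φ) s v v
      = ∫ x in Ω, ‖gradient v.1 x‖ ^ 2 := by
    intro s v
    refine integral_congr_ae ?_
    filter_upwards [hφ] with x hx
    rw [hx, one_mul, real_inner_self_eq_norm_sq]
  simpa only [e] using h

lemma integrableOn_l2Inner_combo (hΩ : Bornology.IsBounded Ω) (ht : IsTimeMesh T t)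
    (c : Fin N × Fin 2 → feSpace Ω K) :
    IntegrableOn (fun s => l2Form K hΩ (combo _ (timeBasis t) s c) (combo _ (timeBasis t) s c))
      (Ioo 0 T) :=
  integrableOn_form_combo (b := fun _ => l2Form K hΩ) (fun _ _ => continuousOn_const)
    (fun i j => integrableOn_mul_timeBasis ht (integrableOn_timeBasis ht i) j) c c

lemma integrableOn_omega_mul_l2Inner_combo (hΩ : Bornology.IsBounded Ω) (hμ1 : μ < 1)
    (ht : IsTimeMesh T t) (c : Fin N × Fin 2 → feSpace Ω K) :
    IntegrableOn (fun s => omega (1 - μ) s / 2 *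
      l2Form K hΩ (combo _ (timeBasis t) s c) (combo _ (timeBasis t) s c)) (Ioo 0 T) := by
  have hT : 0 ≤ T := (ht.mem_Icc 0).1.trans (ht.mem_Icc 0).2
  have h := integrableOn_form_combo (b := fun _ => l2Form K hΩ) (T := T)
    (φ := fun i s => omega (1 - μ) s / 2 * timeBasis t i s) (ψ := timeBasis t)
    (fun _ _ => continuousOn_const) (fun i j => integrableOn_mul_timeBasis ht
      (integrableOn_mul_timeBasis ht ((integrableOn_omega hμ1 hT).div_const 2) i) j) c c
  refine h.congr (Eventually.of_forall fun s => ?_)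
  have : combo (feSpace Ω K) (fun i s => omega (1 - μ) s / 2 * timeBasis t i s) s c
      = (omega (1 - μ) s / 2) • combo _ (timeBasis t) s c := by
    simp only [combo_apply, Finset.smul_sum, smul_smul]
  simp only [this, map_smul, LinearMap.smul_apply, smul_eq_mul]

lemma h1NormSq_eq (hΩ : Bornology.IsBounded Ω) (v : feSpace Ω K) :
    h1NormSq Ω v.1 = l2Form K hΩ v v + ∫ x in Ω, ‖gradient v.1 x‖ ^ 2 := by
  simp only [h1NormSq, l2Form_apply, l2Inner, pow_two]

/-- The stability constant, in terms of the Poincaré constant `P`. -/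
noncomputable def stabilityConst (μ amin P : ℝ) : ℝ :=
  (1 + P) * (2 / amin) * (P / (2 * amin) + 1 / (2 * ((1 - μ) * Real.Gamma (1 - μ))))

/-- The energy estimate for the discontinuous Galerkin scheme. -/
lemma integral_h1NormSq_le (ho : IsOpen Ω) (hΩ : Bornology.IsBounded Ω)
    (hK : IsTriangulation Ω K) (hμ0 : 0 < μ) (hμ1 : μ < 1) (hT : 0 < T) (ht : IsTimeMesh T t)
    {A : ℝ → Lp ℝ ∞ (volume.restrict Ω)} {amin amax : ℝ} (hamin : 0 < amin)
    (hA : IsDiffusivity Ω T amin amax A) {P : ℝ} (hP0 : 0 < P)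
    (hP : ∀ v : feSpace Ω K, ∫ x in Ω, v.1 x ^ 2 ≤ P * ∫ x in Ω, ‖gradient v.1 x‖ ^ 2)
    {U0 : Lp ℝ 2 (volume.restrict Ω)} {f : ℝ → Lp ℝ 2 (volume.restrict Ω)}
    (hf : MemLp f 2 (volume.restrict (Ioo 0 T))) {c : Fin N × Fin 2 → feSpace Ω K}
    (hc : ∫ s in Ioo 0 T, schemeIntegrand μ t ho hΩ hK A s c c
      = ∫ s in Ioo 0 T, loadForm K hΩ μ U0 f s (combo _ (timeBasis t) s c)) :
    ∫ s in Ioo 0 T, h1NormSq Ω (combo _ (timeBasis t) s c).1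
      ≤ stabilityConst μ amin P * T ^ (1 - μ) * ‖U0‖ ^ 2
        + stabilityConst μ amin P * ∫ s in Ioo 0 T, ‖f s‖ ^ 2 := by
  set u : ℝ → feSpace Ω K := fun s => combo _ (timeBasis t) s c with hu
  set g : feSpace Ω K → ℝ := fun v => ∫ x in Ω, ‖gradient v.1 x‖ ^ 2 with hg
  set q : feSpace Ω K → ℝ := fun v => l2Form K hΩ v v with hq
  have hAc : ContinuousOn A (Icc 0 T) := hA.contDiff.continuousOn
  have hgi : IntegrableOn (fun s => g (u s)) (Ioo 0 T) :=
    integrableOn_norm_gradient_sq_combo ho hΩ hK ht c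
  have hqi : IntegrableOn (fun s => q (u s)) (Ioo 0 T) := integrableOn_l2Inner_combo hΩ ht c
  have hωq : IntegrableOn (fun s => omega (1 - μ) s / 2 * q (u s)) (Ioo 0 T) :=
    integrableOn_omega_mul_l2Inner_combo hΩ hμ1 ht c
  have hωi := integrableOn_omega (μ := μ) hμ1 hT.le
  have hf2 : IntegrableOn (fun s => ‖f s‖ ^ 2) (Ioo 0 T) := hf.integrable_norm_pow two_ne_zero
  have hD := integrableOn_l2Form_fracBasis (K := K) hΩ hμ1 ht c c
  have hS := integrableOn_stiffnessForm ho hΩ hK ht hAc c c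
  have hqP : ∀ v, q v ≤ P * g v := fun v => by
    have := hP v
    simpa only [hq, hg, l2Form_apply, l2Inner, pow_two] using this
  have hcoer := integral_l2Form_coercive (K := K) hΩ hμ0 hμ1 ht c
  rw [integral_sub hD hωq] at hcoer
  have hlow : ∫ s in Ioo 0 T, amin * g (u s)
      ≤ ∫ s in Ioo 0 T, stiffnessForm ho hΩ hK A s (u s) (u s) := by
    refine setIntegral_mono_on (hgi.const_mul _) hS measurableSet_Ioo fun s hs => ?_
    exact mul_integral_norm_gradient_sq_le_bilin ho hΩ hK hA (Ioo_subset_Icc_self hs) (u s)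
  have hsplit : ∫ s in Ioo 0 T, schemeIntegrand μ t ho hΩ hK A s c c
      = (∫ s in Ioo 0 T, l2Form K hΩ (combo _ (fracBasis μ t) s c) (u s))
        + ∫ s in Ioo 0 T, stiffnessForm ho hΩ hK A s (u s) (u s) := integral_add hD hS
  have hi1 := hgi.const_mul (amin / 2)
  have hi2 := hf2.const_mul (P / (2 * amin))
  have hi3 := hωi.mul_const (‖U0‖ ^ 2 / 2)
  -- Young's inequality with two weights. The `U0` term is split evenly, so that ω/2 · q cancels
  -- against `hcoer`; the `f` term is split so that Poincaré turns its share of q into amin/2 · g,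
  -- half of the diffusion.
  have hup : ∫ s in Ioo 0 T, loadForm K hΩ μ U0 f s (u s)
      ≤ ∫ s in Ioo 0 T, (((amin / 2 * g (u s) + P / (2 * amin) * ‖f s‖ ^ 2)
          + omega (1 - μ) s * (‖U0‖ ^ 2 / 2)) + omega (1 - μ) s / 2 * q (u s)) := by
    refine setIntegral_mono_on (integrableOn_loadForm hΩ hμ1 ht U0 hf c)
      (((hi1.add hi2).add hi3).add hωq) measurableSet_Ioo fun s hs => ?_
    rw [loadForm_apply]
    have hω := omega_nonneg hμ1 hs.1.le
    have hn : ‖toL2 K hΩ (u s)‖ ^ 2 = q (u s) := norm_toL2_sq hΩ (u s)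
    have h1 := real_inner_le_norm (f s) (toL2 K hΩ (u s))
    have h2 := real_inner_le_norm U0 (toL2 K hΩ (u s))
    have h3 : ‖U0‖ * ‖toL2 K hΩ (u s)‖ ≤ ‖U0‖ ^ 2 / 2 + q (u s) / 2 := by
      rw [← hn]; nlinarith [sq_nonneg (‖U0‖ - ‖toL2 K hΩ (u s)‖)]
    have h4 : ‖f s‖ * ‖toL2 K hΩ (u s)‖ ≤ P / (2 * amin) * ‖f s‖ ^ 2 + amin / (2 * P) * q (u s) := by
      rw [← hn]
      set y := ‖toL2 K hΩ (u s)‖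
      have e : P / (2 * amin) * ‖f s‖ ^ 2 + amin / (2 * P) * y ^ 2 - ‖f s‖ * y
          = (P * ‖f s‖ - amin * y) ^ 2 / (2 * amin * P) := by
        field_simp; ring
      have : 0 ≤ (P * ‖f s‖ - amin * y) ^ 2 / (2 * amin * P) := by positivity
      linarith
    have h5 : amin / (2 * P) * q (u s) ≤ amin / 2 * g (u s) := by
      calc _ ≤ amin / (2 * P) * (P * g (u s)) :=
            mul_le_mul_of_nonneg_left (hqP _) (by positivity)
        _ = _ := by field_simp
    have h6 := mul_le_mul_of_nonneg_left (h2.trans h3) hω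
    linarith
  have i1 : ∫ s in Ioo 0 T, (((amin / 2 * g (u s) + P / (2 * amin) * ‖f s‖ ^ 2)
      + omega (1 - μ) s * (‖U0‖ ^ 2 / 2)) + omega (1 - μ) s / 2 * q (u s))
      = (((∫ s in Ioo 0 T, amin / 2 * g (u s)) + ∫ s in Ioo 0 T, P / (2 * amin) * ‖f s‖ ^ 2)
      + ∫ s in Ioo 0 T, omega (1 - μ) s * (‖U0‖ ^ 2 / 2))
      + ∫ s in Ioo 0 T, omega (1 - μ) s / 2 * q (u s) :=
    (integral_add ((hi1.add hi2).add hi3) hωq).trans <| congrArg (· + _) <|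
      (integral_add (hi1.add hi2) hi3).trans <| congrArg (· + _) <| integral_add hi1 hi2
  have i2 : ∫ s in Ioo 0 T, omega (1 - μ) s = T ^ (1 - μ) / ((1 - μ) * Real.Gamma (1 - μ)) := by
    rw [← integral_omega hμ1, intervalIntegral.integral_of_le hT.le, integral_Ioc_eq_integral_Ioo]
  rw [i1, integral_const_mul, integral_const_mul, integral_mul_const, i2] at hup
  rw [integral_const_mul] at hlow
  have hmain : amin / 2 * ∫ s in Ioo 0 T, g (u s) ≤ P / (2 * amin) * (∫ s in Ioo 0 T, ‖f s‖ ^ 2)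
      + T ^ (1 - μ) / ((1 - μ) * Real.Gamma (1 - μ)) * (‖U0‖ ^ 2 / 2) := by
    rw [← hc, hsplit] at hup
    linarith
  have hh1 : ∫ s in Ioo 0 T, h1NormSq Ω (u s).1 ≤ (1 + P) * ∫ s in Ioo 0 T, g (u s) := by
    rw [← integral_const_mul]
    simp only [h1NormSq_eq hΩ]
    refine integral_mono (hqi.add hgi) (hgi.const_mul _) fun s => ?_
    have := hqP (u s)
    change q (u s) + g (u s) ≤ _
    linarith
  have hμ' : 0 < 1 - μ := by linarith
  have hG : 0 < Real.Gamma (1 - μ) := Real.Gamma_pos_of_pos hμ'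
  set D := (1 - μ) * Real.Gamma (1 - μ) with hDdef
  have hD0 : 0 < D := by positivity
  set F := ∫ s in Ioo 0 T, ‖f s‖ ^ 2 with hF
  have hF0 : 0 ≤ F := integral_nonneg fun s => by positivity
  have hTp : 0 ≤ T ^ (1 - μ) := Real.rpow_nonneg hT.le _
  have hW0 : 0 ≤ T ^ (1 - μ) * ‖U0‖ ^ 2 := by positivity
  calc ∫ s in Ioo 0 T, h1NormSq Ω (u s).1 ≤ (1 + P) * ∫ s in Ioo 0 T, g (u s) := hh1
    _ = (1 + P) * (2 / amin) * (amin / 2 * ∫ s in Ioo 0 T, g (u s)) := by field_simp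
    _ ≤ (1 + P) * (2 / amin) * (P / (2 * amin) * F + T ^ (1 - μ) / D * (‖U0‖ ^ 2 / 2)) :=
        mul_le_mul_of_nonneg_left hmain (by positivity)
    _ = (1 + P) * (2 / amin) * (P / (2 * amin) * F + 1 / (2 * D) * (T ^ (1 - μ) * ‖U0‖ ^ 2)) := by
        field_simp
    -- Nonnegative cross terms are added to give both data terms the same constant.
    _ ≤ (1 + P) * (2 / amin) * (P / (2 * amin) * F + 1 / (2 * D) * (T ^ (1 - μ) * ‖U0‖ ^ 2)
          + (P / (2 * amin) * (T ^ (1 - μ) * ‖U0‖ ^ 2) + 1 / (2 * D) * F)) := by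
        refine mul_le_mul_of_nonneg_left (le_add_of_nonneg_right ?_) (by positivity)
        positivity
    _ = _ := by rw [stabilityConst, ← hDdef]; ring

/-- The extension by zero is continuous on all of ℝ^d, so a vanishing integral of its square gives v
= 0 everywhere, not merely almost everywhere. -/
lemma feSpace_eq_zero_of_l2Form_eq_zero (hΩ : Bornology.IsBounded Ω)
    {v : feSpace Ω K} (hv : l2Form K hΩ v v = 0) : v = 0 := by
  have h1 : ∫ x, v.1 x * v.1 x = 0 := by
    rw [← hv, l2Form_apply, l2Inner]
    exact (setIntegral_eq_integral_of_forall_compl_eq_zero fun x hx => by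
      simp [feSpace_eq_zero v hx]).symm
  rw [integral_eq_zero_iff_of_nonneg (fun x => mul_self_nonneg _) (feSpace_integrable_mul hΩ v v)] at h1
  have hc : Continuous fun x => v.1 x * v.1 x := (feSpace_continuous v).mul (feSpace_continuous v)
  have h2 := (hc.ae_eq_iff_eq volume (g := 0) continuous_zero).1 h1
  ext x
  have := congrFun h2 x
  simpa using this

/-- A kernel element satisfies the energy identity with zero data, so the stability estimate makes
its H¹ norm vanish for almost every time. -/
lemma schemeForm_injective (ho : IsOpen Ω) (hΩ : Bornology.IsBounded Ω)
    (hK : IsTriangulation Ω K) (hμ0 : 0 < μ) (hμ1 : μ < 1) (hT : 0 < T) (ht : IsTimeMesh T t)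
    {A : ℝ → Lp ℝ ∞ (volume.restrict Ω)} {amin amax : ℝ} (hamin : 0 < amin)
    (hA : IsDiffusivity Ω T amin amax A) {P : ℝ} (hP0 : 0 < P)
    (hP : ∀ v : feSpace Ω K, ∫ x in Ω, v.1 x ^ 2 ≤ P * ∫ x in Ω, ‖gradient v.1 x‖ ^ 2) :
    Function.Injective (schemeForm ho hΩ hK hμ1 ht hA.contDiff.continuousOn) := by
  refine (injective_iff_map_eq_zero _).2 fun c hc => ?_
  have henergy : ∫ s in Ioo 0 T, schemeIntegrand μ t ho hΩ hK A s c c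
      = ∫ s in Ioo 0 T, loadForm K hΩ μ 0 (fun _ => 0) s (combo _ (timeBasis t) s c) := by
    have h1 : ∫ s in Ioo 0 T, schemeIntegrand μ t ho hΩ hK A s c c = 0 :=
      LinearMap.congr_fun hc c
    rw [h1]
    simp [loadForm_apply]
  have h2 := integral_h1NormSq_le ho hΩ hK hμ0 hμ1 hT ht hamin hA hP0 hP
    (f := fun _ => 0) MemLp.zero' henergy
  simp only [norm_zero, ne_eq, OfNat.ofNat_ne_zero, not_false_eq_true, zero_pow, mul_zero,
    integral_zero, add_zero, h1NormSq_eq hΩ] at h2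
  have hqn : ∀ v : feSpace Ω K, 0 ≤ l2Form K hΩ v v := fun v =>
    integral_nonneg fun x => mul_self_nonneg _
  have hgn : ∀ v : feSpace Ω K, 0 ≤ ∫ x in Ω, ‖gradient v.1 x‖ ^ 2 := fun v =>
    integral_nonneg fun x => sq_nonneg _
  have h3 : ∀ s, 0 ≤ l2Form K hΩ (combo _ (timeBasis t) s c) (combo _ (timeBasis t) s c)
      + ∫ x in Ω, ‖gradient (combo _ (timeBasis t) s c).1 x‖ ^ 2 :=
    fun s => add_nonneg (hqn _) (hgn _)
  have h4 := le_antisymm h2 (integral_nonneg h3)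
  rw [integral_eq_zero_iff_of_nonneg h3 ((integrableOn_l2Inner_combo hΩ ht c).add
    (integrableOn_norm_gradient_sq_combo ho hΩ hK ht c))] at h4
  have h5 : ∀ᵐ s ∂(volume.restrict (Ioo 0 T)), combo _ (timeBasis t) s c = 0 := by
    filter_upwards [h4] with s hs
    refine feSpace_eq_zero_of_l2Form_eq_zero hΩ ?_
    have h6 : l2Form K hΩ (combo _ (timeBasis t) s c) (combo _ (timeBasis t) s c)
      + ∫ x in Ω, ‖gradient (combo _ (timeBasis t) s c).1 x‖ ^ 2 = 0 := hs
    linarith [hqn (combo _ (timeBasis t) s c), hgn (combo _ (timeBasis t) s c)]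
  -- An affine function of time that vanishes at two distinct times of an interval is zero.
  have h6 : ∀ n, c (n, 0) = 0 ∧ c (n, 1) = 0 := by
    intro n
    have hlt : t n.castSucc < t n.succ := ht.strictMono Fin.castSucc_lt_succ
    have hne : (ae (volume.restrict (timeInterval t n))).NeBot := by
      rw [ae_neBot, ne_eq, Measure.restrict_eq_zero]
      simp [timeInterval, hlt]
    have h7 : ∀ᵐ s ∂(volume.restrict (timeInterval t n)), c (n, 0) + s • c (n, 1) = 0 := by
      filter_upwards [ae_restrict_of_ae_restrict_of_subset (ht.timeInterval_subset n) h5,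
        ae_restrict_mem measurableSet_Ioo] with s hs hs2
      rw [← hs, combo_timeBasis ht (hs2 : s ∈ timeInterval t n)]
    obtain ⟨s1, hs1⟩ := h7.exists
    have h8 : ∀ᵐ s ∂(volume.restrict (timeInterval t n)), s ≠ s1 :=
      ae_restrict_of_ae (by simp [ae_iff])
    obtain ⟨s2, hs2, hs21⟩ := (h7.and h8).exists
    have h9 : (s2 - s1) • c (n, 1) = 0 := by
      have : (s2 - s1) • c (n, 1) = (c (n, 0) + s2 • c (n, 1)) - (c (n, 0) + s1 • c (n, 1)) := by
        module
      rw [this, hs1, hs2, sub_zero]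
    have h10 : c (n, 1) = 0 := (smul_eq_zero.1 h9).resolve_left (sub_ne_zero.2 hs21)
    refine ⟨?_, h10⟩
    simpa [h10] using hs1
  ext1 ⟨n, j⟩
  fin_cases j
  exacts [(h6 n).1, (h6 n).2]

/-- The coefficients of the function that equals `p + s q` on `I_n` and vanishes elsewhere. -/
def localCoeff {V : Type*} [Zero V] (n : Fin N) (p q : V) (i : Fin N × Fin 2) : V :=
  if i.1 = n then (if i.2 = 0 then p else q) else 0

lemma sum_localCoeff {V : Type*} [AddCommGroup V] (e : Fin N × Fin 2 → V) :
    e = ∑ n, localCoeff n (e (n, 0)) (e (n, 1)) := by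
  ext1 ⟨m, j⟩
  rw [Finset.sum_apply, Finset.sum_eq_single m]
  · fin_cases j <;> simp [localCoeff]
  · intro n _ hn
    simp [localCoeff, hn.symm]
  · simp

lemma combo_localCoeff_of_notMem {V : Type*} [AddCommGroup V] [Module ℝ V] {n : Fin N} {s : ℝ}
    (hs : s ∉ timeInterval t n) (p q : V) :
    combo V (timeBasis t) s (localCoeff n p q) = 0 := by
  refine combo_timeBasis_eq_zero _ fun m hm => ?_
  have : m ≠ n := fun h => hs (h ▸ hm)
  simp [localCoeff, this]

lemma combo_localCoeff_of_mem (ht : IsTimeMesh T t) {V : Type*} [AddCommGroup V] [Module ℝ V]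
    {n : Fin N} {s : ℝ} (hs : s ∈ timeInterval t n) (p q : V) :
    combo V (timeBasis t) s (localCoeff n p q) = p + s • q := by
  simp [combo_timeBasis ht hs, localCoeff]

/-- The derivative has memory of all earlier intervals, so one global family of coefficients is
needed. The unconstrained values of `U` at mesh points form a null set, and those outside [0,T] are
never integrated. -/
lemma rlDeriv_eq_combo (hμ1 : μ < 1) (ht : IsTimeMesh T t) {U : ℝ → feSpace Ω K}
    {c : Fin N × Fin 2 → feSpace Ω K}
    (hU : ∀ n, ∀ s ∈ timeInterval t n, U s = combo _ (timeBasis t) s c) {n : Fin N} {s : ℝ}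
    (hs : s ∈ timeInterval t n) :
    rlDeriv μ (fun r => (U r : EuclideanSpace ℝ (Fin d) → ℝ)) s
      = (combo _ (fracBasis μ t) s c : feSpace Ω K).1 := by
  have hS : (range t).Countable := countable_range t
  ext x
  change deriv (fracInt μ fun r => (U r).1 x) s = _
  have e : ∀ᵐ r, r ∈ Ioo 0 T → (U r).1 x = ∑ i, (c i).1 x * timeBasis t i r := by
    filter_upwards [hS.ae_notMem volume] with r hr hr2
    obtain ⟨m, hm⟩ := ht.exists_mem ⟨hr2, hr⟩
    rw [hU m r hm, combo_apply]
    simp [mul_comm]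
  have hs2 : s ∈ Ioo 0 T \ range t := ⟨ht.timeInterval_subset n hs, ht.notMem_range hs⟩
  rw [deriv_fracInt_congr_ae e hs2.1, HasFracDeriv.deriv_sum hS _
    (fun i _ => (hasFracDeriv_timeBasis hμ1 ht i).const_mul _) hs2, combo_apply]
  simp only [deriv_fracInt_const_mul]
  simp [fracBasis, mul_comm]

lemma exists_coeff {U : ℝ → feSpace Ω K} (ht : IsTimeMesh T t) (hU : IsDGFunction Ω K t U) :
    ∃ c : Fin N × Fin 2 → feSpace Ω K,
      ∀ n, ∀ s ∈ timeInterval t n, U s = combo _ (timeBasis t) s c := by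
  choose p q hpq using hU
  refine ⟨fun i => if i.2 = 0 then p i.1 else q i.1, fun n s hs => ?_⟩
  rw [combo_timeBasis ht hs, hpq n s hs]
  simp

/-- The scheme is equivalent to a square linear system for the coefficients. -/
lemma isDGSolution_iff (ho : IsOpen Ω) (hΩ : Bornology.IsBounded Ω)
    (hK : IsTriangulation Ω K) (hμ1 : μ < 1) (ht : IsTimeMesh T t)
    {A : ℝ → Lp ℝ ∞ (volume.restrict Ω)} (hA : ContinuousOn A (Icc 0 T))
    (U0 : Lp ℝ 2 (volume.restrict Ω)) {f : ℝ → Lp ℝ 2 (volume.restrict Ω)}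
    (hf : MemLp f 2 (volume.restrict (Ioo 0 T))) {U : ℝ → feSpace Ω K}
    {c : Fin N × Fin 2 → feSpace Ω K}
    (hU : ∀ n, ∀ s ∈ timeInterval t n, U s = combo _ (timeBasis t) s c) :
    IsDGSolution μ Ω A K t U0 f U ↔
      schemeForm ho hΩ hK hμ1 ht hA c = loadFunctional hΩ hμ1 ht U0 hf := by
  -- A test function supported in one interval turns the global form into the local equation;
  -- conversely `sum_localCoeff` writes every test function as a sum of such.
  have hl : ∀ n (p q : feSpace Ω K), (∫ s in timeInterval t n,
      (l2Inner Ω (rlDeriv μ (fun r => (U r : EuclideanSpace ℝ (Fin d) → ℝ)) s) (p + s • q).1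
        + bilin Ω A s (U s).1 (p + s • q).1))
      = schemeForm ho hΩ hK hμ1 ht hA c (localCoeff n p q) := by
    intro n p q
    change _ = ∫ s in Ioo 0 T, schemeIntegrand μ t ho hΩ hK A s c (localCoeff n p q)
    refine Eq.trans ?_ (setIntegral_eq_of_subset_of_forall_sdiff_eq_zero measurableSet_Ioo
      (ht.timeInterval_subset n) ?_).symm
    · refine setIntegral_congr_fun measurableSet_Ioo fun s hs => ?_
      simp only [schemeIntegrand_apply, combo_localCoeff_of_mem ht hs, rlDeriv_eq_combo hμ1 ht hU hs,
        hU n s hs, l2Form_apply, stiffnessForm_apply]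
    · intro s hs
      rw [schemeIntegrand_apply, combo_localCoeff_of_notMem hs.2, map_zero, map_zero, add_zero]
  have hr : ∀ n (p q : feSpace Ω K), (∫ s in timeInterval t n,
      l2Inner Ω (fun x => f s x + omega (1 - μ) s * U0 x) (p + s • q).1)
      = loadFunctional hΩ hμ1 ht U0 hf (localCoeff n p q) := by
    intro n p q
    change _ = ∫ s in Ioo 0 T, loadForm K hΩ μ U0 f s (combo _ (timeBasis t) s (localCoeff n p q))
    refine Eq.trans ?_ (setIntegral_eq_of_subset_of_forall_sdiff_eq_zero measurableSet_Ioo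
      (ht.timeInterval_subset n) ?_).symm
    · refine setIntegral_congr_fun measurableSet_Ioo fun s hs => ?_
      simp only [combo_localCoeff_of_mem ht hs]
      exact loadForm_eq_l2Inner hΩ U0 f s (p + s • q)
    · intro s hs
      rw [combo_localCoeff_of_notMem hs.2, map_zero]
  constructor
  · intro h
    refine LinearMap.ext fun e => ?_
    rw [sum_localCoeff e, map_sum, map_sum]
    exact Finset.sum_congr rfl fun n _ => by rw [← hl, ← hr, h.scheme]
  · intro h
    refine ⟨fun n => ⟨c (n, 0), c (n, 1), fun s hs => ?_⟩, fun n p q => ?_⟩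
    · rw [hU n s hs, combo_timeBasis ht hs]
    · rw [hl, hr, h]

end Stability

end FracDG

/-! ### The main theorem. -/

theorem theorem3 (d : ℕ) (hd1 : 1 ≤ d) (hd3 : d ≤ 3)
    (Ω : Set (EuclideanSpace ℝ (Fin d))) (hΩ : FracDG.IsConvexPolytopalDomain Ω)
    (μ : ℝ) (hμ0 : 0 < μ) (hμ1 : μ < 1) (amin : ℝ) (hamin : 0 < amin) :
    ∃ C : ℝ, 0 < C ∧
      ∀ (T : ℝ), 0 < T →
      ∀ (amax : ℝ) (A : ℝ → Lp ℝ ∞ (volume.restrict Ω)), FracDG.IsDiffusivity Ω T amin amax A →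
      ∀ K : Geometry.SimplicialComplex ℝ (EuclideanSpace ℝ (Fin d)), FracDG.IsTriangulation Ω K →
      ∀ (N : ℕ) (t : Fin (N + 1) → ℝ), FracDG.IsTimeMesh T t →
      ∀ (U0 : Lp ℝ 2 (volume.restrict Ω)) (f : ℝ → Lp ℝ 2 (volume.restrict Ω)),
        MemLp f 2 (volume.restrict (Ioo 0 T)) →
        (∀ U : ℝ → FracDG.feSpace Ω K, FracDG.IsDGSolution μ Ω A K t U0 f U →
          ∫ s in Ioo 0 T, FracDG.h1NormSq Ω (U s).1
            ≤ C * T ^ (1 - μ) * ‖U0‖ ^ 2 + C * ∫ s in Ioo 0 T, ‖f s‖ ^ 2) ∧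
        (∀ U V : ℝ → FracDG.feSpace Ω K,
          FracDG.IsDGSolution μ Ω A K t U0 f U → FracDG.IsDGSolution μ Ω A K t U0 f V →
          ∀ n : Fin N, EqOn U V (FracDG.timeInterval t n)) ∧
        (∃ U : ℝ → FracDG.feSpace Ω K, FracDG.IsDGSolution μ Ω A K t U0 f U) := by
  have ho := hΩ.isOpen
  have hb := hΩ.isBounded
  obtain ⟨P, hP0, hP⟩ := FracDG.exists_poincare hd1 ho hb
  refine ⟨FracDG.stabilityConst μ amin P, ?_, ?_⟩
  · have h1 : 0 < 1 - μ := by linarith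
    have := Real.Gamma_pos_of_pos h1
    unfold FracDG.stabilityConst
    positivity
  intro T hT amax A hA K hK N t ht U0 f hf
  have hAc : ContinuousOn A (Icc 0 T) := hA.contDiff.continuousOn
  have hinj := FracDG.schemeForm_injective ho hb hK hμ0 hμ1 hT ht hamin hA hP0 (hP K hK)
  refine ⟨fun U hU => ?_, fun U V hU hV n s hs => ?_, ?_⟩
  · obtain ⟨c, hc⟩ := FracDG.exists_coeff ht hU.isDGFunction
    have hsys := (FracDG.isDGSolution_iff ho hb hK hμ1 ht hAc U0 hf hc).1 hU
    have hle := FracDG.integral_h1NormSq_le ho hb hK hμ0 hμ1 hT ht hamin hA hP0 (hP K hK) hf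
      (LinearMap.congr_fun hsys c)
    -- The solution agrees with its coefficient representation off the mesh points, a null set.
    refine le_of_eq_of_le (integral_congr_ae ?_) hle
    filter_upwards [FracDG.ae_restrict_Ioo_diff (countable_range t)] with s hs
    obtain ⟨n, hn⟩ := ht.exists_mem hs
    rw [hc n s hn]
  · obtain ⟨c, hc⟩ := FracDG.exists_coeff ht hU.isDGFunction
    obtain ⟨e, he⟩ := FracDG.exists_coeff ht hV.isDGFunction
    have h1 := (FracDG.isDGSolution_iff ho hb hK hμ1 ht hAc U0 hf hc).1 hU
    have h2 := (FracDG.isDGSolution_iff ho hb hK hμ1 ht hAc U0 hf he).1 hV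
    rw [hc n s hs, he n s hs, hinj (h1.trans h2.symm)]
  -- The system maps the coefficient space injectively into its dual, which has the same finite
  -- dimension, so every load functional is attained.
  · have := FracDG.feSpace_finiteDimensional hK
    obtain ⟨c, hc⟩ := (LinearMap.injective_iff_surjective_of_finrank_eq_finrank
      (Subspace.dual_finrank_eq (K := ℝ) (V := Fin N × Fin 2 → FracDG.feSpace Ω K)).symm).1 hinj
      (FracDG.loadFunctional hb hμ1 ht U0 hf)
    exact ⟨_, (FracDG.isDGSolution_iff ho hb hK hμ1 ht hAc U0 hf fun _ _ _ => rfl).2 hc⟩
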